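/- For integers $k_1,\dots,k_{d-1}\ge 1$ and $k_d\ge 2$ let $\zeta(k_1,\dots,k_d)=\sum_{0<n_1<\cdots<n_d} n_1^{-k_1}\cdots n_d^{-k_d}$, and for integers $k\ge 2$, $r\ge 0$ put $$Z(k,r)=\sum_{j\ge 0}\ \sum_{\substack{(r_1,\dots,r_j)\in\{1,2\}^j\\ r_1+\cdots+r_j=r}} 2^{\#\{i\,:\,r_i=1\}}\,\zeta(r_1,\dots,r_j,k).$$ For $p\in\mathbb{Z}$ and integers $q>r\ge 0$ define $C(p,q,r)$ by the identity of formal power series in $y$ $$\sum_{q=r+1}^{\infty} C(p,q,r)\,y^{q-1}=\frac{2+y}{(1-y)^{p+1}}\left(\frac{1-\sqrt{1-4y}}{2}\right)^{r}.$$ For integers $p,q$ with $q\ge 1$ and $p+q\ge 1$ define $$e_{p,q}=\sum_{r=0}^{q-1}(-1)^r\,C(p,q,r)\,Z(2p+3q-r,\,r).$$ (Here $2p+3q-r\ge 2$, so the numbers $Z(2p+3q-r,r)$ are given by convergent series.) Then $e_{p,q}=0$ for all integers $p,q$ with $-q<p<0$. -/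

import Mathlib

namespace Virasoro

/-- The multiple zeta value
`ζ(k₁, …, k_d) = ∑_{0 < n₁ < ⋯ < n_d} n₁^{-k₁} ⋯ n_d^{-k_d}` of the list `[k₁, …, k_d]`. -/
noncomputable def mzv (s : List ℕ) : ℝ :=
  ∑' n : {n : Fin s.length → ℕ // StrictMono n ∧ ∀ i, 0 < n i},
    ∏ i, ((n.1 i : ℝ) ^ s.get i)⁻¹

/-- `Z(k, r) = ∑ 2^{#{i : rᵢ = 1}} ζ(r₁, …, r_j, k)`, the sum over all `j ≥ 0` and all
`(r₁, …, r_j) ∈ {1, 2}^j` with `r₁ + ⋯ + r_j = r`. A `Composition r` is a finite sequence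
of positive integers with sum `r`. -/
noncomputable def Z (k r : ℕ) : ℝ :=
  ∑ c : Composition r with ∀ b ∈ c.blocks, b = 1 ∨ b = 2,
    2 ^ c.blocks.count 1 * mzv (c.blocks ++ [k])

/-- The unit `1 - y` of the ring of formal power series `ℚ⟦y⟧`. -/
noncomputable def oneSub : (PowerSeries ℚ)ˣ where
  val := 1 - PowerSeries.X
  inv := PowerSeries.mk 1
  val_inv := by rw [mul_comm, PowerSeries.mk_one_mul_one_sub_eq_one]
  inv_val := PowerSeries.mk_one_mul_one_sub_eq_one ℚ

/-- The power series `√(1 - 4y) = ∑ₙ binom(1/2, n) (-4y)ⁿ`. -/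
noncomputable def sqrtOneSubFour : PowerSeries ℚ :=
  PowerSeries.rescale (-4) (PowerSeries.binomialSeries ℚ (1 / 2 : ℚ))

theorem sqrtOneSubFour_sq : sqrtOneSubFour ^ 2 = 1 - 4 * PowerSeries.X := by
  have h : PowerSeries.binomialSeries ℚ (1 / 2 : ℚ) ^ 2 = 1 + PowerSeries.X := by
    rw [sq, ← PowerSeries.binomialSeries_add]
    have := PowerSeries.binomialSeries_nat (R := ℚ) (A := ℚ) 1
    norm_num at this ⊢
    exact this
  rw [sqrtOneSubFour, ← map_pow, h, map_add, map_one, PowerSeries.rescale_X]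
  rw [map_neg, map_ofNat, sub_eq_add_neg, neg_mul]

theorem sqrtOneSubFour_constantCoeff : PowerSeries.constantCoeff sqrtOneSubFour = 1 := by
  rw [← PowerSeries.coeff_zero_eq_constantCoeff_apply, sqrtOneSubFour, PowerSeries.coeff_rescale]
  simp

/-- The power series `(2 + y) / (1 - y)^{p+1} * ((1 - √(1 - 4y)) / 2)^r` for `p ∈ ℤ`, `r ≥ 0`. -/
noncomputable def genC (p : ℤ) (r : ℕ) : PowerSeries ℚ :=
  (2 + PowerSeries.X) * ((oneSub ^ (-(p + 1)) : (PowerSeries ℚ)ˣ) : PowerSeries ℚ) *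
    (PowerSeries.C (1 / 2 : ℚ) * (1 - sqrtOneSubFour)) ^ r

/-- For `q ≥ 1`, the number `C(p, q, r)` is the coefficient of `y^{q-1}` in
`(2 + y) / (1 - y)^{p+1} * ((1 - √(1 - 4y)) / 2)^r`. -/
noncomputable def C (p : ℤ) (q r : ℕ) : ℚ :=
  PowerSeries.coeff (q - 1) (genC p r)

/-- `e_{p,q} = ∑_{r=0}^{q-1} (-1)^r C(p, q, r) Z(2p + 3q - r, r)` for `q ≥ 1`, `p + q ≥ 1`; in this
range the integer `2p + 3q - r` is at least `3`. -/
noncomputable def e (p : ℤ) (q : ℕ) : ℝ :=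
  ∑ r ∈ Finset.range q, (-1) ^ r * (C p q r : ℝ) * Z (2 * p + 3 * q - r).toNat r

theorem summable_prod_pi {f : ℕ → ℝ} (hf : Summable f) (h0 : ∀ n, 0 ≤ f n) (d : ℕ) :
    Summable fun n : Fin d → ℕ => ∏ i, f (n i) := by
  induction d with
  | zero => exact (hasSum_fintype _).summable
  | succ d ih =>
    rw [← (Fin.consEquiv fun _ : Fin (d + 1) => ℕ).summable_iff]
    have := hf.mul_of_nonneg ih h0 (fun n => Finset.prod_nonneg fun i _ => h0 _)
    refine this.congr fun x => ?_
    simp [Fin.consEquiv, Fin.prod_univ_succ]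

/-- The series defining `ζ(k₁, …, k_d, k)` converges if `kᵢ ≥ 1` for all `i` and `k ≥ 2`. -/
theorem summable_mzv (s : List ℕ) (hs : ∀ b ∈ s, 1 ≤ b) (k : ℕ) (hk : 2 ≤ k) :
    Summable fun n : {n : Fin (s ++ [k]).length → ℕ // StrictMono n ∧ ∀ i, 0 < n i} =>
      ∏ i, ((n.1 i : ℝ) ^ (s ++ [k]).get i)⁻¹ := by
  set l := s ++ [k] with hl
  have hlen : l.length = s.length + 1 := by simp [hl]
  set d := l.length with hd
  have hdpos : (0 : ℝ) < d := by rw [hlen]; positivity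
  set a : ℝ := 1 + 1 / d with ha
  have ha1 : 1 < a := by rw [ha]; linarith [one_div_pos.2 hdpos]
  have hsum : Summable fun n : ℕ => ((n : ℝ) ^ a)⁻¹ := Real.summable_nat_rpow_inv.2 ha1
  have hall := summable_prod_pi hsum (fun n => by positivity) d
  refine Summable.of_nonneg_of_le (fun n => Finset.prod_nonneg fun i _ => by positivity) ?_
    (hall.comp_injective (Subtype.val_injective
      (p := fun n : Fin d → ℕ => StrictMono n ∧ ∀ i, 0 < n i)))
  rintro ⟨n, hmono, hpos⟩
  have hposr : ∀ i, (1 : ℝ) ≤ n i := fun i => by exact_mod_cast hpos i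
  let m : Fin d := ⟨s.length, by omega⟩
  have hge : ∀ i, l.get i = l[i.1]'i.2 := fun i => rfl
  have hm : 2 ≤ l.get m := by simp [m, hl, hk]
  have h1 : ∀ i, 1 ≤ l.get i := fun i => by
    have : l.get i ∈ s ++ [k] := List.get_mem l i
    rcases List.mem_append.1 this with h | h
    · exact hs _ h
    · rw [List.mem_singleton.1 h]; omega
  have hle : ∀ i, n i ≤ n m := fun i => hmono.monotone (by
    rw [Fin.le_def]; have := i.2; simp only [m]; omega)
  simp only [Function.comp_apply, Finset.prod_inv_distrib]
  refine inv_anti₀ (Finset.prod_pos fun i _ => Real.rpow_pos_of_pos (by linarith [hposr i]) _) ?_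
  calc ∏ i, (n i : ℝ) ^ a = (∏ i, (n i : ℝ)) * ∏ i, (n i : ℝ) ^ (1 / (d : ℝ)) := by
        rw [← Finset.prod_mul_distrib]
        refine Finset.prod_congr rfl fun i _ => ?_
        rw [ha, Real.rpow_add (by linarith [hposr i]), Real.rpow_one]
    _ ≤ (∏ i, (n i : ℝ)) * ∏ _i : Fin d, (n m : ℝ) ^ (1 / (d : ℝ)) := by
        gcongr with i
        exact hle i
    _ = (∏ i, (n i : ℝ)) * n m := by
        rw [Finset.prod_const, Finset.card_univ, Fintype.card_fin, ← Real.rpow_natCast,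
          ← Real.rpow_mul (by positivity), one_div_mul_cancel hdpos.ne', Real.rpow_one]
    _ = ∏ i, (n i : ℝ) ^ (if i = m then 2 else 1) := by
        rw [← Finset.mul_prod_erase _ _ (Finset.mem_univ m),
          ← Finset.mul_prod_erase Finset.univ (fun i => (n i : ℝ) ^ (if i = m then 2 else 1))
            (Finset.mem_univ m)]
        have : ∏ i ∈ Finset.univ.erase m, (n i : ℝ) ^ (if i = m then 2 else 1) =
            ∏ i ∈ Finset.univ.erase m, (n i : ℝ) :=
          Finset.prod_congr rfl fun i hi => by simp [(Finset.mem_erase.1 hi).1]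
        rw [this, if_pos rfl]
        ring
    _ ≤ ∏ i, (n i : ℝ) ^ l.get i := by
        gcongr with i
        · exact hposr i
        · split_ifs with h
          · rw [h]; exact hm
          · exact h1 i

end Virasoro

/-! Write p = -(α + 1). Grouping by the largest index, Z(k, r) is the sum over ν ≥ 1 of ν^(-k) times
the coefficient of X^r in ∏_{0<m<ν} (1 + X/m)² (`coeff_sqProd`, `hasSum_Z`). Hence e_{p,q} is the
sum over ν of ν^(-(2p+3q)) times the coefficient of y^(q-1) in (2 + y)(1 - y)^α ∏_{0<m<ν} (1 -
νU/m)², where U - U² = y. Pairing m with ν - m shows that the product is a polynomial in y, so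
Lagrange inversion for y = z - z² turns this into a coefficient in z (`sum_C_mul_coeff_sqProd`).

These terms are limits of residues. For s + t + u = 0 and x = su, put σ₂ = x - t², σ₃ = xt, and
consider the truncated product over 0 < m ≤ N of (m+s)(m+t)(m+u) / ((m-s)(m-t)(m-u)), a power series
in σ₂ and σ₃. Since dσ₂ ∧ dσ₃ = (x + 2t²) dx ∧ dt, the coefficient of x^q t^q in σ₂^α (x + 2t²)
times this product is the residue of a combination of forms σ₂^i σ₃^(j-q-1) dσ₂ ∧ dσ₃. These are
exact, so it vanishes (`bicoeff_diag_symm`, `residueFree_prod`).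

The same coefficient is, by partial fractions in x, minus the coefficient of t^q in the sum of the
residues at x = -ν(ν + t), ν ≤ N. There is no residue at infinity because α + 1 < q, which is the
hypothesis -q < p (`coeff_sum_residues`). After t = -νz the residue at ν is the ν-th term of
e_{p,q}, up to a common sign and a correction factor tending to 1 as N grows (`rescale_residue`,
`coeff_residue`). Dominated convergence gives the theorem. -/

namespace Virasoro

/-! ### Z(k, r) as a single series over the largest summation index. The index `n` stands for ν = n
+ 1 throughout. -/

open Finset

open Classical in
/-- Strictly increasing sequences of length `d` with entries in the open interval `(0, n)`. -/
noncomputable def chains (d n : ℕ) : Finset (Fin d → ℕ) :=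
  (Fintype.piFinset fun _ : Fin d => Ioo 0 n).filter StrictMono

theorem mem_chains {d n : ℕ} {f : Fin d → ℕ} :
    f ∈ chains d n ↔ (∀ i, 0 < f i ∧ f i < n) ∧ StrictMono f := by
  simp [chains]

theorem strictMono_snoc_iff {d m : ℕ} {f : Fin d → ℕ} :
    StrictMono (Fin.snoc (α := fun _ => ℕ) f m) ↔ StrictMono f ∧ ∀ i, f i < m := by
  constructor
  · intro h
    refine ⟨fun i j hij => ?_, fun i => ?_⟩
    · simpa using h (Fin.castSucc_lt_castSucc_iff.2 hij)
    · simpa using h (Fin.castSucc_lt_last i)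
  · rintro ⟨h, hm⟩ i j hij
    induction j using Fin.lastCases with
    | last =>
      induction i using Fin.lastCases with
      | last => exact absurd hij (lt_irrefl _)
      | cast i => simpa using hm i
    | cast j =>
      induction i using Fin.lastCases with
      | last => exact absurd hij (not_lt.2 (Fin.le_last _))
      | cast i => simpa using h (Fin.castSucc_lt_castSucc_iff.1 hij)

/-- The truncated multiple harmonic sum over the chains in `(0, n)` with exponents `κ`. -/
noncomputable def truncSum {d : ℕ} (κ : Fin d → ℕ) (n : ℕ) : ℝ :=
  ∑ f ∈ chains d n, ∏ i, ((f i : ℝ) ^ κ i)⁻¹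

theorem truncSum_snoc {d : ℕ} (κ : Fin d → ℕ) (k n : ℕ) :
    truncSum (Fin.snoc (α := fun _ => ℕ) κ k) n =
      ∑ m ∈ Ioo 0 n, ((m : ℝ) ^ k)⁻¹ * truncSum κ m := by
  simp only [truncSum, mul_sum]
  rw [sum_sigma']
  symm
  refine sum_nbij' (fun x => Fin.snoc (α := fun _ => ℕ) x.2 x.1)
    (fun g => ⟨g (Fin.last d), Fin.init (α := fun _ => ℕ) g⟩) ?_ ?_ ?_ ?_ ?_
  · rintro ⟨m, f⟩ h
    simp only [mem_sigma, mem_Ioo, mem_chains] at h ⊢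
    refine ⟨fun i => ?_, strictMono_snoc_iff.2 ⟨h.2.2, fun i => (h.2.1 i).2⟩⟩
    induction i using Fin.lastCases with
    | last => simpa using h.1
    | cast i => simpa using ⟨(h.2.1 i).1, (h.2.1 i).2.trans h.1.2⟩
  · intro g h
    rw [mem_chains] at h
    simp only [mem_sigma, mem_Ioo, mem_chains]
    refine ⟨h.1 _, fun i => ⟨(h.1 _).1, h.2 (Fin.castSucc_lt_last i)⟩, fun i j hij => ?_⟩
    exact h.2 (Fin.castSucc_lt_castSucc_iff.2 hij)
  · rintro ⟨m, f⟩ _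
    simp
  · intro g _
    simp
  · rintro ⟨m, f⟩ _
    simp [Fin.prod_univ_castSucc, mul_comm]

/-- The series is fibred over its last, hence largest, entry n + 1. Each fibre is the finite set of
chains below n + 1, and summability permits the regrouping. -/
theorem hasSum_truncSum {d : ℕ} (κ : Fin d → ℕ) (k : ℕ)
    (hs : Summable fun n : {n : Fin (d + 1) → ℕ // StrictMono n ∧ ∀ i, 0 < n i} =>
      ∏ i, ((n.1 i : ℝ) ^ Fin.snoc (α := fun _ => ℕ) κ k i)⁻¹) :
    HasSum (fun n : ℕ => (((n + 1 : ℕ) : ℝ) ^ k)⁻¹ * truncSum κ (n + 1))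
      (∑' n : {n : Fin (d + 1) → ℕ // StrictMono n ∧ ∀ i, 0 < n i},
        ∏ i, ((n.1 i : ℝ) ^ Fin.snoc (α := fun _ => ℕ) κ k i)⁻¹) := by
  let φ : (Σ n : ℕ, {f // f ∈ chains d (n + 1)}) →
      {n : Fin (d + 1) → ℕ // StrictMono n ∧ ∀ i, 0 < n i} := fun x =>
    ⟨Fin.snoc (α := fun _ => ℕ) x.2.1 (x.1 + 1), by
      have h := mem_chains.1 x.2.2
      refine ⟨strictMono_snoc_iff.2 ⟨h.2, fun i => (h.1 i).2⟩, fun i => ?_⟩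
      induction i using Fin.lastCases with
      | last => simp
      | cast i => simpa using (h.1 i).1⟩
  have hφ : Function.Bijective φ := by
    constructor
    · rintro ⟨n, f, hf⟩ ⟨m, g, hg⟩ h
      have h' := congrArg Subtype.val h
      simp only [φ] at h'
      have h1 := congrFun h' (Fin.last d)
      simp only [Fin.snoc_last, add_left_inj] at h1
      subst h1
      have h2 : f = g := by
        funext i
        simpa using congrFun h' i.castSucc
      subst h2
      rfl
    · rintro ⟨g, hg, hpos⟩
      have hl := hpos (Fin.last d)
      refine ⟨⟨g (Fin.last d) - 1, Fin.init (α := fun _ => ℕ) g, mem_chains.2 ⟨fun i => ⟨hpos _, ?_⟩,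
        fun i j hij => hg (Fin.castSucc_lt_castSucc_iff.2 hij)⟩⟩, Subtype.ext ?_⟩
      · rw [Nat.sub_add_cancel hl]
        exact hg (Fin.castSucc_lt_last i)
      · simp only [φ]
        rw [Nat.sub_add_cancel hl]
        simp
  have h := (Equiv.hasSum_iff (Equiv.ofBijective φ hφ)).2 hs.hasSum
  refine h.sigma fun n => ?_
  have h2 := hasSum_fintype fun f : {f // f ∈ chains d (n + 1)} =>
    ∏ i, (((Fin.snoc (α := fun _ => ℕ) f.1 (n + 1) i : ℕ) : ℝ) ^ Fin.snoc (α := fun _ => ℕ) κ k i)⁻¹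
  have h3 : (((n + 1 : ℕ) : ℝ) ^ k)⁻¹ * truncSum κ (n + 1) =
      ∑ f : {f // f ∈ chains d (n + 1)}, ∏ i, (((Fin.snoc (α := fun _ => ℕ) f.1 (n + 1) i : ℕ) : ℝ) ^
        Fin.snoc (α := fun _ => ℕ) κ k i)⁻¹ := by
    rw [truncSum, mul_sum, ← sum_coe_sort]
    refine sum_congr rfl fun f _ => ?_
    simp [Fin.prod_univ_castSucc, mul_comm]
  rw [h3]
  exact h2

/-- The truncated multiple harmonic sum attached to a list of exponents. -/
noncomputable def listSum (l : List ℕ) (n : ℕ) : ℝ := truncSum l.get n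

theorem listSum_nil (n : ℕ) : listSum [] n = 1 := by
  have h : chains ([] : List ℕ).length n = {fun i => i.elim0} := by
    ext f
    rw [mem_chains, mem_singleton]
    constructor
    · intro _
      funext i
      exact i.elim0
    · rintro rfl
      exact ⟨fun i => i.elim0, fun i => i.elim0⟩
  rw [listSum, truncSum, h]
  simp

theorem get_append_singleton (s : List ℕ) (k : ℕ) (h : (s ++ [k]).length = s.length + 1)
    (i : Fin (s.length + 1)) :
    (s ++ [k]).get (Fin.cast h.symm i) = Fin.snoc (α := fun _ => ℕ) s.get k i := by
  induction i using Fin.lastCases with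
  | last => simp
  | cast i => simp

/-- The length of `s ++ [k]` equals `s.length + 1` only propositionally. This transports a statement
about a list to the function given by `Fin.snoc`. -/
theorem exists_cast {l : List ℕ} {d : ℕ} (h : l.length = d) (κ : Fin d → ℕ)
    (hκ : ∀ i, l.get (Fin.cast h.symm i) = κ i) (Q : (d : ℕ) → (Fin d → ℕ) → Prop)
    (hQ : Q l.length l.get) : Q d κ := by
  subst h
  have : l.get = κ := funext hκ
  rwa [this] at hQ

theorem listSum_append (s : List ℕ) (k n : ℕ) :
    listSum (s ++ [k]) n = ∑ m ∈ Ioo 0 n, ((m : ℝ) ^ k)⁻¹ * listSum s m := by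
  have h := exists_cast (l := s ++ [k]) (by simp) _ (get_append_singleton s k (by simp))
    (fun d κ => listSum (s ++ [k]) n = truncSum κ n) rfl
  rw [h, truncSum_snoc]
  rfl

theorem hasSum_mzv (s : List ℕ) (hs : ∀ b ∈ s, 1 ≤ b) (k : ℕ) (hk : 2 ≤ k) :
    HasSum (fun n : ℕ => (((n + 1 : ℕ) : ℝ) ^ k)⁻¹ * listSum s (n + 1)) (mzv (s ++ [k])) := by
  have h := exists_cast (l := s ++ [k]) (by simp) _ (get_append_singleton s k (by simp))
    (fun d κ => mzv (s ++ [k]) = ∑' n : {n : Fin d → ℕ // StrictMono n ∧ ∀ i, 0 < n i},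
        ∏ i, ((n.1 i : ℝ) ^ κ i)⁻¹) rfl
  have h2 := exists_cast (l := s ++ [k]) (by simp) _ (get_append_singleton s k (by simp))
    (fun d κ => Summable fun n : {n : Fin d → ℕ // StrictMono n ∧ ∀ i, 0 < n i} =>
        ∏ i, ((n.1 i : ℝ) ^ κ i)⁻¹) (summable_mzv s hs k hk)
  rw [h]
  exact hasSum_truncSum _ k h2

/-- The lists with entries in `{1, 2}` and sum `r`. -/
noncomputable def oneTwoLists (r : ℕ) : Finset (List ℕ) :=
  (univ.filter fun c : Composition r => ∀ b ∈ c.blocks, b = 1 ∨ b = 2).image Composition.blocks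

theorem mem_oneTwoLists {r : ℕ} {l : List ℕ} :
    l ∈ oneTwoLists r ↔ (∀ b ∈ l, b = 1 ∨ b = 2) ∧ l.sum = r := by
  simp only [oneTwoLists, mem_image, mem_filter, mem_univ, true_and]
  constructor
  · rintro ⟨c, hc, rfl⟩
    exact ⟨hc, c.blocks_sum⟩
  · rintro ⟨h, hs⟩
    refine ⟨⟨l, fun {i} hi => ?_, hs⟩, h, rfl⟩
    rcases h i hi with h | h <;> omega

theorem Z_eq_sum (k r : ℕ) :
    Z k r = ∑ l ∈ oneTwoLists r, 2 ^ l.count 1 * mzv (l ++ [k]) := by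
  rw [oneTwoLists, sum_image, Z]
  intro c _ c' _ h
  exact Composition.ext h

theorem sum_oneTwoLists_zero (f : List ℕ → ℝ) : ∑ l ∈ oneTwoLists 0, f l = f [] := by
  have : oneTwoLists 0 = {[]} := by
    ext l
    rw [mem_oneTwoLists, mem_singleton]
    constructor
    · rintro ⟨h, hs⟩
      rcases l with _ | ⟨b, l⟩
      · rfl
      · have := h b (by simp)
        simp at hs
        omega
    · rintro rfl
      simp
  rw [this, sum_singleton]

theorem sum_oneTwoLists_one (f : List ℕ → ℝ) : ∑ l ∈ oneTwoLists 1, f l = f [1] := by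
  have : oneTwoLists 1 = {[1]} := by
    ext l
    rw [mem_oneTwoLists, mem_singleton]
    constructor
    · rintro ⟨h, hs⟩
      rcases l with _ | ⟨b, _ | ⟨b', l⟩⟩
      · simp at hs
      · simpa using hs
      · have := h b (by simp)
        have := h b' (by simp)
        simp at hs
        omega
    · rintro rfl
      simp
  rw [this, sum_singleton]

theorem sum_oneTwoLists_add_two (f : List ℕ → ℝ) (r : ℕ) :
    ∑ l ∈ oneTwoLists (r + 2), f l =
      ∑ l ∈ oneTwoLists (r + 1), f (l ++ [1]) + ∑ l ∈ oneTwoLists r, f (l ++ [2]) := by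
  have hinj (b : ℕ) : Function.Injective fun l : List ℕ => l ++ [b] :=
    List.append_left_injective _
  have h : oneTwoLists (r + 2) = (oneTwoLists (r + 1)).map ⟨_, hinj 1⟩ ∪
      (oneTwoLists r).map ⟨_, hinj 2⟩ := by
    ext l
    simp only [mem_union, mem_map, mem_oneTwoLists, Function.Embedding.coeFn_mk]
    constructor
    · rintro ⟨h, hs⟩
      rcases List.eq_nil_or_concat l with rfl | ⟨l, b, rfl⟩
      · simp at hs
      · simp only [List.concat_eq_append] at h hs ⊢
        rw [List.sum_append] at hs
        have hb := h b (by simp)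
        have hl : ∀ c ∈ l, c = 1 ∨ c = 2 := fun c hc => h c (by simp [hc])
        rcases hb with rfl | rfl
        · exact Or.inl ⟨l, ⟨hl, by simpa using hs⟩, rfl⟩
        · exact Or.inr ⟨l, ⟨hl, by simpa using hs⟩, rfl⟩
    · rintro (⟨l, ⟨h, hs⟩, rfl⟩ | ⟨l, ⟨h, hs⟩, rfl⟩)
      · refine ⟨fun b hb => ?_, by simp [hs]⟩
        rcases List.mem_append.1 hb with hb | hb
        · exact h b hb
        · left; simpa using hb
      · refine ⟨fun b hb => ?_, by simp [hs]⟩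
        rcases List.mem_append.1 hb with hb | hb
        · exact h b hb
        · right; simpa using hb
  rw [h, sum_union, sum_map, sum_map]
  · rfl
  · rw [disjoint_left]
    intro l h1 h2
    simp only [mem_map, Function.Embedding.coeFn_mk] at h1 h2
    obtain ⟨a, _, rfl⟩ := h1
    obtain ⟨b, _, hb⟩ := h2
    have := (List.append_inj' hb rfl).2
    simp at this

/-- The polynomial `∏_{0 < m ≤ n} (1 + X / m)²`. -/
noncomputable def sqProd (n : ℕ) : Polynomial ℝ :=
  ∏ m ∈ range n, (1 + Polynomial.C ((m + 1 : ℝ)⁻¹) * Polynomial.X) ^ 2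

theorem listSum_append_succ (s : List ℕ) (k n : ℕ) :
    listSum (s ++ [k]) (n + 2) =
      listSum (s ++ [k]) (n + 1) + ((n + 1 : ℝ) ^ k)⁻¹ * listSum s (n + 1) := by
  rw [listSum_append, listSum_append]
  have : Ioo 0 (n + 2) = insert (n + 1) (Ioo 0 (n + 1)) := by
    ext i
    simp only [mem_Ioo, mem_insert]
    omega
  rw [this, sum_insert (by simp)]
  push_cast
  ring

/-- The new factor is 1 + 2X/(n+1) + X²/(n+1)². Its three terms mean: do not use the index n + 1,
append an entry 1 with weight 2, or append an entry 2 with weight 1. This is the source of the power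
of 2 in Z. -/
theorem coeff_sqProd (n r : ℕ) :
    (sqProd n).coeff r = ∑ l ∈ oneTwoLists r, 2 ^ l.count 1 * listSum l (n + 1) := by
  induction n generalizing r with
  | zero =>
    have h (s : List ℕ) (k : ℕ) : listSum (s ++ [k]) 1 = 0 := by
      rw [listSum_append, show Ioo 0 1 = (∅ : Finset ℕ) from rfl, sum_empty]
    rcases r with _ | _ | r
    · rw [sum_oneTwoLists_zero]
      simp [sqProd, listSum_nil]
    · rw [sum_oneTwoLists_one]
      have := h [] 1
      simp only [List.nil_append] at this
      simp [sqProd, this, Polynomial.coeff_one]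
    · rw [sum_oneTwoLists_add_two]
      simp [sqProd, h, Polynomial.coeff_one]
  | succ n ih =>
    have hs : sqProd (n + 1) = sqProd n + Polynomial.C (2 * (n + 1 : ℝ)⁻¹) * sqProd n * Polynomial.X
        + Polynomial.C (((n + 1 : ℝ) ^ 2)⁻¹) * sqProd n * Polynomial.X ^ 2 := by
      rw [sqProd, prod_range_succ, ← sqProd]
      simp only [Polynomial.C_mul, ← inv_pow, Polynomial.C_pow]
      rw [show (Polynomial.C 2 : Polynomial ℝ) = 2 from rfl]
      ring
    rw [hs]
    rcases r with _ | _ | r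
    · have h0 := ih 0
      rw [sum_oneTwoLists_zero, listSum_nil] at h0 ⊢
      simp [h0]
    · have h0 := ih 0
      have h1 := ih 1
      rw [sum_oneTwoLists_zero, listSum_nil] at h0
      rw [sum_oneTwoLists_one] at h1 ⊢
      have h2 := listSum_append_succ [] 1 n
      rw [List.nil_append, listSum_nil] at h2
      rw [h2]
      have h3 : ∀ p : Polynomial ℝ, (p * Polynomial.X ^ 2).coeff 1 = 0 := fun p => by
        rw [Polynomial.coeff_mul_X_pow']
        simp
      simp only [Polynomial.coeff_add, h3, zero_add, Polynomial.coeff_mul_X,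
        Polynomial.coeff_C_mul, h1, h0]
      simp
      ring
    · simp only [Polynomial.coeff_add, Polynomial.coeff_mul_X_pow,
        Polynomial.coeff_C_mul]
      rw [show r + 1 + 1 = (r + 1) + 1 from rfl, Polynomial.coeff_mul_X,
        Polynomial.coeff_C_mul, ih, ih, ih]
      rw [sum_oneTwoLists_add_two, sum_oneTwoLists_add_two]
      simp only [listSum_append_succ, List.count_append, List.count_singleton]
      simp only [mul_sum, beq_self_eq_true, if_true, mul_add, sum_add_distrib, pow_add, pow_one,
        show ((2 : ℕ) == 1) = false from rfl, Bool.false_eq_true, if_false, pow_zero, mul_one]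
      have e1 : ∑ x ∈ oneTwoLists (r + 1), (2:ℝ) ^ List.count 1 x * 2 * ((n + 1 : ℝ)⁻¹ * listSum x (n + 1))
        = ∑ i ∈ oneTwoLists (r + 1), 2 * (n + 1 : ℝ)⁻¹ * (2 ^ List.count 1 i * listSum i (n + 1)) :=
        sum_congr rfl fun _ _ => by ring
      have e2 : ∑ x ∈ oneTwoLists r, (2:ℝ) ^ List.count 1 x * (((n + 1 : ℝ) ^ 2)⁻¹ * listSum x (n + 1))
        = ∑ i ∈ oneTwoLists r, ((n + 1 : ℝ) ^ 2)⁻¹ * (2 ^ List.count 1 i * listSum i (n + 1)) :=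
        sum_congr rfl fun _ _ => by ring
      rw [e1, e2]
      ring

theorem hasSum_Z (k r : ℕ) (hk : 2 ≤ k) :
    HasSum (fun n : ℕ => (((n + 1 : ℕ) : ℝ) ^ k)⁻¹ * (sqProd n).coeff r) (Z k r) := by
  rw [Z_eq_sum]
  have h := hasSum_sum fun l (hl : l ∈ oneTwoLists r) =>
    (hasSum_mzv l (fun b hb => by rcases (mem_oneTwoLists.1 hl).1 b hb with h | h <;> omega)
      k hk).mul_left ((2 : ℝ) ^ l.count 1)
  refine h.congr_fun ?_
  intro n
  rw [coeff_sqProd, mul_sum]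
  exact sum_congr rfl fun _ _ => by ring

end Virasoro

/-! ### Reflection symmetry and Lagrange inversion. -/

namespace Virasoro

open Finset

/-- The polynomial in `y = u - u²` that equals `∏_{0 < m ≤ n} (1 - (n + 1) u / m)²`. -/
noncomputable def reflPoly (n : ℕ) : Polynomial ℝ :=
  ∏ m ∈ range n, (1 - Polynomial.C ((n + 1 : ℝ) ^ 2 / ((m + 1) * (n - m))) * Polynomial.X)

theorem aeval_sqProd {A : Type*} [CommRing A] [Algebra ℝ A] (n : ℕ) (U : A) :
    Polynomial.aeval (algebraMap ℝ A (-(n + 1 : ℝ)) * U) (sqProd n) =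
      ∏ m ∈ range n, (1 - algebraMap ℝ A ((n + 1 : ℝ) / (m + 1)) * U) ^ 2 := by
  rw [sqProd, map_prod]
  refine prod_congr rfl fun m _ => ?_
  simp only [map_pow, map_add, map_one, map_mul, Polynomial.aeval_C, Polynomial.aeval_X]
  rw [← mul_assoc, ← map_mul]
  rw [show (m + 1 : ℝ)⁻¹ * (-(n + 1)) = -((n + 1 : ℝ) / (m + 1)) by ring, map_neg]
  ring

/-- Reflecting one of the two copies of the product pairs m with ν - m, where ν = n + 1, and 1/m +
1/(ν - m) = ν/(m(ν - m)). So the sum and the product of ν/m and ν/(ν - m) coincide, and U enters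
only through U - U². -/
theorem prod_sq_eq_aeval_reflPoly {A : Type*} [CommRing A] [Algebra ℝ A] (n : ℕ) (U : A) :
    ∏ m ∈ range n, (1 - algebraMap ℝ A ((n + 1 : ℝ) / (m + 1)) * U) ^ 2 =
      Polynomial.aeval (U - U ^ 2) (reflPoly n) := by
  simp only [sq]
  rw [prod_mul_distrib]
  nth_rewrite 2 [← prod_range_reflect]
  rw [← prod_mul_distrib, reflPoly, map_prod]
  refine prod_congr rfl fun m hm => ?_
  have hm' := mem_range.1 hm
  have h1 : ((n - 1 - m : ℕ) : ℝ) + 1 = n - m := by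
    rw [← Nat.cast_sub hm'.le]
    norm_cast
    omega
  rw [h1]
  have h2 : (n : ℝ) - m ≠ 0 := by
    rw [sub_ne_zero]
    exact_mod_cast hm'.ne'
  have h3 : (m : ℝ) + 1 ≠ 0 := by positivity
  simp only [map_sub, map_one, map_mul, Polynomial.aeval_C, Polynomial.aeval_X]
  have e1 : ((n : ℝ) + 1) / (m + 1) + (n + 1) / (n - m) = (n + 1) ^ 2 / ((m + 1) * (n - m)) := by
    field_simp
    ring
  have e2 : ((n : ℝ) + 1) / (m + 1) * ((n + 1) / (n - m)) = (n + 1) ^ 2 / ((m + 1) * (n - m)) := by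
    field_simp
  have e1' := congrArg (algebraMap ℝ A) e1
  have e2' := congrArg (algebraMap ℝ A) e2
  rw [map_add] at e1'
  rw [map_mul] at e2'
  linear_combination U ^ 2 * e2' - U * e1'

open PowerSeries in
-- This is binom(2i, i) = 2 binom(2i - 1, i) for i > 0. It is the orthogonality relation behind the
-- inversion formula below.
theorem coeff_one_sub_two_mul_invOneSubPow (i : ℕ) :
    coeff i ((1 - 2 * X) * (invOneSubPow ℝ (i + 1)).val) = if i = 0 then 1 else 0 := by
  rw [invOneSubPow_val_succ_eq_mk_add_choose, sub_mul, one_mul, mul_assoc, map_sub,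
    show (2 : ℝ⟦X⟧) = PowerSeries.C 2 from rfl, coeff_C_mul, coeff_mk]
  rcases i with _ | i
  · simp
  · rw [coeff_succ_X_mul, coeff_mk, if_neg (by omega)]
    have h : (i + 1 + (i + 1)).choose (i + 1) = 2 * (i + 1 + i).choose (i + 1) := by
      have h1 := Nat.choose_succ_succ (i + 1 + i) i
      have h2 := Nat.choose_symm_half i
      rw [show 2 * i + 1 = i + 1 + i by ring] at h2
      rw [show i + 1 + (i + 1) = (i + 1 + i).succ by rfl, h1, ← h2]
      simp only [Nat.succ_eq_add_one]
      omega
    rw [h]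
    push_cast
    ring

open PowerSeries in
/-- Lagrange inversion for the substitution `y = u - u²`. -/
theorem coeff_eq_coeff_aeval (k : ℕ) (g : Polynomial ℝ) :
    g.coeff k = coeff k ((1 - 2 * X) * (invOneSubPow ℝ (k + 1)).val *
      Polynomial.aeval (X - X ^ 2 : ℝ⟦X⟧) g) := by
  induction g using Polynomial.induction_on' with
  | add f g hf hg => rw [map_add, mul_add, map_add, Polynomial.coeff_add, hf, hg]
  | monomial j c =>
    rw [Polynomial.aeval_monomial, Polynomial.coeff_monomial, PowerSeries.algebraMap_apply,
      Algebra.algebraMap_self_apply, mul_left_comm, coeff_C_mul,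
      show (X - X ^ 2 : ℝ⟦X⟧) = X * (1 - X) by ring, mul_pow, mul_left_comm, coeff_X_pow_mul']
    rcases lt_or_ge k j with h | h
    · rw [if_neg (by omega), if_neg (by omega), mul_zero]
    · obtain ⟨i, rfl⟩ := Nat.exists_eq_add_of_le h
      rw [if_pos h, show j + i + 1 = i + 1 + j by ring, mul_assoc,
        mul_comm _ ((1 - X : ℝ⟦X⟧) ^ j), one_sub_pow_mul_invOneSubPow_val_add_eq_invOneSubPow_val,
        Nat.add_sub_cancel_left, coeff_one_sub_two_mul_invOneSubPow]
      by_cases hi : i = 0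
      · simp [hi]
      · rw [if_neg hi, if_neg (by omega), mul_zero]

open PowerSeries in
/-- The power series `(1 - √(1 - 4y)) / 2` over `ℝ`. -/
noncomputable def catalanRoot : ℝ⟦X⟧ :=
  PowerSeries.map (algebraMap ℚ ℝ) (PowerSeries.C (1 / 2 : ℚ) * (1 - sqrtOneSubFour))

open PowerSeries in
theorem catalanRoot_sub_sq : catalanRoot - catalanRoot ^ 2 = X := by
  rw [catalanRoot, ← map_pow, ← map_sub, ← PowerSeries.map_X (algebraMap ℚ ℝ)]
  congr 1
  have h := sqrtOneSubFour_sq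
  have h2 : (2 : ℚ⟦X⟧) * PowerSeries.C (1 / 2 : ℚ) = 1 := by
    rw [show (2 : ℚ⟦X⟧) = PowerSeries.C 2 from rfl, ← map_mul]
    norm_num
  set c : ℚ⟦X⟧ := PowerSeries.C (1 / 2 : ℚ)
  linear_combination (-c ^ 2) * h + (2 * c * X + X - c * (1 - sqrtOneSubFour)) * h2

open PowerSeries in
theorem X_dvd_catalanRoot : X ∣ catalanRoot := by
  rw [X_dvd_iff, catalanRoot, ← coeff_zero_eq_constantCoeff_apply, coeff_map,
    coeff_zero_eq_constantCoeff_apply, map_mul, map_sub, sqrtOneSubFour_constantCoeff]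
  simp

open PowerSeries in
theorem cast_C_eq_coeff (α q r : ℕ) :
    ((C (-(α + 1 : ℤ)) q r : ℚ) : ℝ) =
      coeff (q - 1) ((2 + X) * (1 - X) ^ α * catalanRoot ^ r) := by
  have h1 : (-(-(α + 1 : ℤ) + 1)) = (α : ℤ) := by ring
  have h2 : PowerSeries.map (algebraMap ℚ ℝ) (genC (-(α + 1 : ℤ)) r) =
      (2 + X) * (1 - X) ^ α * catalanRoot ^ r := by
    rw [genC, map_mul, map_mul, map_pow, ← catalanRoot, h1, zpow_natCast,
      Units.val_pow_eq_pow_val, oneSub, map_pow, map_add, map_sub, map_one, PowerSeries.map_X,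
      map_ofNat]
  rw [C, ← eq_ratCast (algebraMap ℚ ℝ), ← coeff_map, h2]

open PowerSeries in
/-- The generating series in `u` whose coefficient gives the `n`-th term of `e_{p,q}`. -/
noncomputable def termSeries (α Q n : ℕ) : ℝ⟦X⟧ :=
  (1 - 2 * X) * (invOneSubPow ℝ (Q + 1)).val *
    ((2 + (X - X ^ 2)) * (1 - (X - X ^ 2)) ^ α *
      ∏ m ∈ range n, (1 - PowerSeries.C ((n + 1 : ℝ) / (m + 1)) * X) ^ 2)

open PowerSeries in
-- The same polynomial g in y is evaluated twice: at y = U - U² with U the Catalan root, which gives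
-- the left side, and at y = X - X², which gives the right side by Lagrange inversion.
theorem sum_C_mul_coeff_sqProd (α Q n : ℕ) :
    ∑ r ∈ range (Q + 1), (C (-(α + 1 : ℤ)) (Q + 1) r : ℝ) * (-(n + 1 : ℝ)) ^ r * (sqProd n).coeff r =
      coeff Q (termSeries α Q n) := by
  let g : Polynomial ℝ :=
    (2 + Polynomial.X) * (1 - Polynomial.X) ^ α * reflPoly n
  have hg (V : ℝ⟦X⟧) : Polynomial.aeval (V - V ^ 2) g = (2 + (V - V ^ 2)) * (1 - (V - V ^ 2)) ^ α *
      ∏ m ∈ range n, (1 - PowerSeries.C ((n + 1 : ℝ) / (m + 1)) * V) ^ 2 := by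
    simp only [g, map_mul, map_add, map_sub, map_pow, map_one, Polynomial.aeval_X, map_ofNat]
    have := prod_sq_eq_aeval_reflPoly n V
    rw [← this]
    rfl
  have h1 : coeff Q (termSeries α Q n) = g.coeff Q := by
    rw [coeff_eq_coeff_aeval, hg, termSeries]
  have h2 : g.coeff Q = coeff Q ((2 + X) * (1 - X) ^ α *
      ∏ m ∈ range n, (1 - PowerSeries.C ((n + 1 : ℝ) / (m + 1)) * catalanRoot) ^ 2) := by
    have h := hg catalanRoot
    rw [catalanRoot_sub_sq] at h
    rw [← h, ← Polynomial.coeff_coe]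
    congr 1
    rw [← Polynomial.eval₂_C_X_eq_coe]
    rfl
  have h3 := aeval_sqProd n catalanRoot
  -- The bound exceeds both the degree and Q, so that `range (Q + 1)` is a subset whatever the
  -- degree is.
  rw [Polynomial.aeval_eq_sum_range' (n := (sqProd n).natDegree + 1 + (Q + 1)) (by omega)] at h3
  rw [h1, h2]
  erw [← h3]
  rw [mul_sum, map_sum, ← sum_subset (range_subset_range.2 (by omega : Q + 1 ≤
    (sqProd n).natDegree + 1 + (Q + 1)))]
  · refine sum_congr rfl fun r _ => ?_
    rw [cast_C_eq_coeff, mul_pow, ← map_pow, PowerSeries.algebraMap_apply, Algebra.algebraMap_self_apply,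
      mul_smul_comm, mul_left_comm, coeff_smul, coeff_C_mul, Nat.add_sub_cancel, smul_eq_mul]
    ring
  -- Terms with r > Q vanish because U^r is divisible by y^r.
  · intro r _ hr
    rw [mul_pow, ← map_pow, PowerSeries.algebraMap_apply, Algebra.algebraMap_self_apply,
      mul_smul_comm, mul_left_comm, coeff_smul, coeff_C_mul]
    have : X ^ r ∣ (2 + X) * (1 - X) ^ α * catalanRoot ^ r :=
      (pow_dvd_pow_of_dvd X_dvd_catalanRoot r).mul_left _
    rw [X_pow_dvd_iff.1 this Q (by simpa using hr)]
    simp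

open PowerSeries in
-- With p = -(α + 1) and q = α + d + 2 one has 2p + 3q = α + 3d + 4. The factor (-(n + 1))^r absorbs
-- both the sign and the shift of the exponent by r.
theorem hasSum_e (α d : ℕ) :
    HasSum (fun n : ℕ => (((n + 1 : ℕ) : ℝ) ^ (α + 3 * d + 4))⁻¹ *
      coeff (α + d + 1) (termSeries α (α + d + 1) n)) (e (-(α + 1 : ℤ)) (α + d + 1 + 1)) := by
  rw [e]
  have h := hasSum_sum fun r (hr : r ∈ range (α + d + 1 + 1)) =>
    (hasSum_Z (α + 3 * d + 4 - r) r (by have := mem_range.1 hr; omega)).mul_left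
      ((-1) ^ r * (C (-(α + 1 : ℤ)) (α + d + 1 + 1) r : ℝ))
  have hval : ∑ r ∈ range (α + d + 1 + 1), (-1) ^ r * (C (-(α + 1 : ℤ)) (α + d + 1 + 1) r : ℝ) *
      Z (2 * -(α + 1 : ℤ) + 3 * (α + d + 1 + 1 : ℕ) - r).toNat r =
      ∑ r ∈ range (α + d + 1 + 1), (-1) ^ r * (C (-(α + 1 : ℤ)) (α + d + 1 + 1) r : ℝ) *
        Z (α + 3 * d + 4 - r) r := by
    refine sum_congr rfl fun r hr => ?_
    have hr' := mem_range.1 hr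
    congr 2
    push_cast
    omega
  rw [hval]
  refine h.congr_fun fun n => ?_
  · rw [← sum_C_mul_coeff_sqProd, mul_sum]
    refine sum_congr rfl fun r hr => ?_
    have hr' := mem_range.1 hr
    have hn : ((n + 1 : ℕ) : ℝ) ≠ 0 := by positivity
    have : ((n + 1 : ℕ) : ℝ) ^ (α + 3 * d + 4) =
        ((n + 1 : ℕ) : ℝ) ^ (α + 3 * d + 4 - r) * ((n + 1 : ℕ) : ℝ) ^ r := by
      rw [← pow_add]
      congr 1
      omega
    rw [this, neg_pow]
    push_cast at hn ⊢
    field_simp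

end Virasoro

/-! ### Vanishing of diagonal coefficients. -/

namespace Virasoro

open Finset

section DiagonalCoefficients

open PowerSeries

/-- The coefficient of `x ^ i * t ^ j` of a power series in `x` over `ℝ⟦t⟧`. -/
noncomputable def bicoeff (i j : ℕ) : ℝ⟦X⟧⟦X⟧ →+ ℝ :=
  (coeff j : ℝ⟦X⟧ →ₗ[ℝ] ℝ).toAddMonoidHom.comp
    (coeff i : ℝ⟦X⟧⟦X⟧ →ₗ[ℝ⟦X⟧] ℝ⟦X⟧).toAddMonoidHom

theorem bicoeff_apply (i j : ℕ) (F : ℝ⟦X⟧⟦X⟧) : bicoeff i j F = coeff j (coeff i F) := rfl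

/-- The variable `t` in `ℝ⟦t⟧⟦x⟧`. -/
noncomputable def varT : ℝ⟦X⟧⟦X⟧ := PowerSeries.C X

theorem bicoeff_ext {F G : ℝ⟦X⟧⟦X⟧} (h : ∀ i j, bicoeff i j F = bicoeff i j G) : F = G := by
  ext i j
  exact h i j

theorem bicoeff_zero_X_mul (j : ℕ) (F : ℝ⟦X⟧⟦X⟧) : bicoeff 0 j (X * F) = 0 := by
  simp [bicoeff_apply]

theorem bicoeff_succ_X_mul (i j : ℕ) (F : ℝ⟦X⟧⟦X⟧) :
    bicoeff (i + 1) j (X * F) = bicoeff i j F := by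
  simp [bicoeff_apply, coeff_succ_X_mul]

theorem bicoeff_zero_varT_mul (i : ℕ) (F : ℝ⟦X⟧⟦X⟧) : bicoeff i 0 (varT * F) = 0 := by
  simp [bicoeff_apply, varT]

theorem bicoeff_succ_varT_mul (i j : ℕ) (F : ℝ⟦X⟧⟦X⟧) :
    bicoeff i (j + 1) (varT * F) = bicoeff i j F := by
  simp [bicoeff_apply, varT, coeff_succ_X_mul]

theorem bicoeff_C_C_mul (i j : ℕ) (c : ℝ) (F : ℝ⟦X⟧⟦X⟧) :
    bicoeff i j (PowerSeries.C (PowerSeries.C c) * F) = c * bicoeff i j F := by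
  simp [bicoeff_apply]

/-- The Euler operator `x ∂/∂x - t ∂/∂t`. -/
noncomputable def eulerDiff (F : ℝ⟦X⟧⟦X⟧) : ℝ⟦X⟧⟦X⟧ :=
  PowerSeries.mk fun i => PowerSeries.mk fun j => ((i : ℝ) - j) * bicoeff i j F

theorem bicoeff_eulerDiff (i j : ℕ) (F : ℝ⟦X⟧⟦X⟧) :
    bicoeff i j (eulerDiff F) = ((i : ℝ) - j) * bicoeff i j F := by
  rw [bicoeff_apply, eulerDiff, coeff_mk, coeff_mk]

theorem eulerDiff_sub (F G : ℝ⟦X⟧⟦X⟧) : eulerDiff (F - G) = eulerDiff F - eulerDiff G :=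
  bicoeff_ext fun i j => by
    rw [map_sub, bicoeff_eulerDiff, bicoeff_eulerDiff, bicoeff_eulerDiff, map_sub, mul_sub]

theorem eulerDiff_one : eulerDiff 1 = 0 :=
  bicoeff_ext fun i j => by
    rw [bicoeff_eulerDiff, bicoeff_apply, coeff_one]
    split_ifs with hi
    · rw [coeff_one]
      split_ifs with hj
      · simp [hi, hj]
      · simp
    · simp

theorem eulerDiff_X_mul (F : ℝ⟦X⟧⟦X⟧) : eulerDiff (X * F) = X * F + X * eulerDiff F :=
  bicoeff_ext fun i j => by
    rw [map_add, bicoeff_eulerDiff]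
    rcases i with _ | i
    · simp only [bicoeff_zero_X_mul, mul_zero, add_zero]
    · simp only [bicoeff_succ_X_mul, bicoeff_eulerDiff]
      push_cast
      ring

theorem eulerDiff_varT_mul (F : ℝ⟦X⟧⟦X⟧) :
    eulerDiff (varT * F) = varT * eulerDiff F - varT * F :=
  bicoeff_ext fun i j => by
    rw [map_sub, bicoeff_eulerDiff]
    rcases j with _ | j
    · simp only [bicoeff_zero_varT_mul, mul_zero, sub_zero]
    · simp only [bicoeff_succ_varT_mul, bicoeff_eulerDiff]
      push_cast
      ring

/-- The second symmetric function `x - t²` of `s, t, u` with `s + t + u = 0` and `x = s u`. -/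
noncomputable def symmTwo : ℝ⟦X⟧⟦X⟧ := X - varT ^ 2

/-- The third symmetric function `x t` of `s, t, u` with `s + t + u = 0` and `x = s u`. -/
noncomputable def symmThree : ℝ⟦X⟧⟦X⟧ := X * varT

theorem eulerDiff_symmTwo_mul (F : ℝ⟦X⟧⟦X⟧) :
    eulerDiff (symmTwo * F) = (X + 2 * varT ^ 2) * F + symmTwo * eulerDiff F := by
  rw [symmTwo, sub_mul, eulerDiff_sub, sq, mul_assoc, eulerDiff_X_mul, eulerDiff_varT_mul,
    eulerDiff_varT_mul]
  ring

theorem eulerDiff_symmThree_mul (F : ℝ⟦X⟧⟦X⟧) :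
    eulerDiff (symmThree * F) = symmThree * eulerDiff F := by
  rw [symmThree, mul_assoc, eulerDiff_X_mul, eulerDiff_varT_mul]
  ring

/-- The Euler operator is a derivation that kills xt and sends x - t² to x + 2t², the Jacobian of
the two symmetric functions. -/
theorem eulerDiff_symm_pow_mul (i j : ℕ) :
    eulerDiff (symmTwo ^ (i + 1) * symmThree ^ j) =
      PowerSeries.C (PowerSeries.C (i + 1 : ℝ)) *
        (symmTwo ^ i * symmThree ^ j * (X + 2 * varT ^ 2)) := by
  have h0 : eulerDiff (symmThree ^ j) = 0 := by
    induction j with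
    | zero => rw [pow_zero, eulerDiff_one]
    | succ j ih => rw [pow_succ', eulerDiff_symmThree_mul, ih, mul_zero]
  induction i with
  | zero =>
    rw [zero_add, pow_one, eulerDiff_symmTwo_mul, h0]
    simp
    ring
  | succ i ih =>
    rw [pow_succ' _ (i + 1), mul_assoc, eulerDiff_symmTwo_mul, ih]
    simp only [map_add, map_one, Nat.cast_add, Nat.cast_one]
    ring

/-- The Euler operator multiplies the coefficient of x^q t^q by q - q = 0, so nothing in its image
has a diagonal coefficient. This is the formal version of the residue of an exact form. -/
theorem bicoeff_diag_symm (q i j : ℕ) :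
    bicoeff q q (symmTwo ^ i * symmThree ^ j * (X + 2 * varT ^ 2)) = 0 := by
  have h := congrArg (bicoeff q q) (eulerDiff_symm_pow_mul i j)
  rw [bicoeff_eulerDiff, sub_self, zero_mul, bicoeff_C_C_mul] at h
  have hi : (i : ℝ) + 1 ≠ 0 := by positivity
  exact (mul_eq_zero.1 h.symm).resolve_left hi

/-- All monomials of `F` have total degree at least `K`. -/
def OrderGE (K : ℕ) (F : ℝ⟦X⟧⟦X⟧) : Prop := ∀ i j, i + j < K → bicoeff i j F = 0

theorem OrderGE.mono {K L : ℕ} {F : ℝ⟦X⟧⟦X⟧} (h : OrderGE K F) (hL : L ≤ K) : OrderGE L F :=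
  fun i j hij => h i j (by omega)

theorem OrderGE.X_mul {K : ℕ} {F : ℝ⟦X⟧⟦X⟧} (h : OrderGE K F) : OrderGE (K + 1) (X * F) := by
  rintro (_ | i) j hij
  · exact bicoeff_zero_X_mul _ _
  · rw [bicoeff_succ_X_mul]
    exact h i j (by omega)

theorem OrderGE.varT_mul {K : ℕ} {F : ℝ⟦X⟧⟦X⟧} (h : OrderGE K F) : OrderGE (K + 1) (varT * F) := by
  rintro i (_ | j) hij
  · exact bicoeff_zero_varT_mul _ _
  · rw [bicoeff_succ_varT_mul]
    exact h i j (by omega)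

theorem OrderGE.symmTwo_mul {K : ℕ} {F : ℝ⟦X⟧⟦X⟧} (h : OrderGE K F) :
    OrderGE (K + 1) (symmTwo * F) := by
  intro i j hij
  rw [symmTwo, sub_mul, map_sub, h.X_mul i j hij, sq, mul_assoc,
    h.varT_mul.varT_mul i j (by omega), sub_zero]

theorem OrderGE.symmThree_mul {K : ℕ} {F : ℝ⟦X⟧⟦X⟧} (h : OrderGE K F) :
    OrderGE (K + 1) (symmThree * F) := by
  rw [symmThree, mul_assoc]
  exact h.varT_mul.X_mul.mono (by omega)

theorem orderGE_symm_pow_mul (i j : ℕ) (F : ℝ⟦X⟧⟦X⟧) :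
    OrderGE (i + j) (symmTwo ^ i * symmThree ^ j * F) := by
  induction i with
  | zero =>
    induction j with
    | zero => intro i j hij; omega
    | succ j ih =>
      have h : symmTwo ^ 0 * symmThree ^ (j + 1) * F =
          symmThree * (symmTwo ^ 0 * symmThree ^ j * F) := by ring
      rw [h]
      exact ih.symmThree_mul
  | succ i ih =>
    rw [pow_succ' symmTwo, mul_assoc, mul_assoc, ← mul_assoc (symmTwo ^ i)]
    exact ih.symmTwo_mul.mono (by omega)

/-- The series `F` all of whose multiples by monomials in the symmetric functions have vanishing
residue against the Jacobian of the symmetric functions. -/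
def ResidueFree (q : ℕ) (F : ℝ⟦X⟧⟦X⟧) : Prop :=
  ∀ i j, bicoeff q q (symmTwo ^ i * symmThree ^ j * (X + 2 * varT ^ 2) * F) = 0

theorem residueFree_one (q : ℕ) : ResidueFree q 1 := fun i j => by
  rw [mul_one, bicoeff_diag_symm]

theorem ResidueFree.mul_num {q : ℕ} {F : ℝ⟦X⟧⟦X⟧} (h : ResidueFree q F) (m : ℝ) :
    ResidueFree q (F * (PowerSeries.C (PowerSeries.C (m ^ 3)) +
      PowerSeries.C (PowerSeries.C m) * symmTwo + symmThree)) := fun i j => by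
  have : symmTwo ^ i * symmThree ^ j * (X + 2 * varT ^ 2) * (F *
      (PowerSeries.C (PowerSeries.C (m ^ 3)) +
        PowerSeries.C (PowerSeries.C m) * symmTwo + symmThree)) =
      PowerSeries.C (PowerSeries.C (m ^ 3)) *
        (symmTwo ^ i * symmThree ^ j * (X + 2 * varT ^ 2) * F) +
      PowerSeries.C (PowerSeries.C m) *
        (symmTwo ^ (i + 1) * symmThree ^ j * (X + 2 * varT ^ 2) * F) +
      symmTwo ^ i * symmThree ^ (j + 1) * (X + 2 * varT ^ 2) * F := by
    ring
  rw [this, map_add, map_add, bicoeff_C_C_mul, bicoeff_C_C_mul, h, h, h]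
  simp

/-- Expanding the hypothesis expresses m³ times the coefficient for (i, j) through those for (i + 1,
j) and (i, j + 1). As m ≠ 0, a descending induction on i + j applies. -/
theorem ResidueFree.of_mul_den {q : ℕ} {H : ℝ⟦X⟧⟦X⟧} {m : ℝ} (hm : m ≠ 0)
    (h : ResidueFree q (H * (PowerSeries.C (PowerSeries.C (m ^ 3)) +
      PowerSeries.C (PowerSeries.C m) * symmTwo - symmThree))) : ResidueFree q H := by
  -- The induction starts at i + j > 2q, where the series has order above the total degree 2q of x^q
  -- t^q.
  have key : ∀ k i j, 2 * q + 1 ≤ i + j + k →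
      bicoeff q q (symmTwo ^ i * symmThree ^ j * (X + 2 * varT ^ 2) * H) = 0 := by
    intro k
    induction k with
    | zero =>
      intro i j hij
      rw [mul_assoc]
      exact orderGE_symm_pow_mul i j _ q q (by omega)
    | succ k ih =>
      intro i j hij
      have h1 := h i j
      have : symmTwo ^ i * symmThree ^ j * (X + 2 * varT ^ 2) * (H *
          (PowerSeries.C (PowerSeries.C (m ^ 3)) +
            PowerSeries.C (PowerSeries.C m) * symmTwo - symmThree)) =
          PowerSeries.C (PowerSeries.C (m ^ 3)) *
            (symmTwo ^ i * symmThree ^ j * (X + 2 * varT ^ 2) * H) +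
          PowerSeries.C (PowerSeries.C m) *
            (symmTwo ^ (i + 1) * symmThree ^ j * (X + 2 * varT ^ 2) * H) -
          symmTwo ^ i * symmThree ^ (j + 1) * (X + 2 * varT ^ 2) * H := by
        ring
      rw [this, map_sub, map_add, bicoeff_C_C_mul, bicoeff_C_C_mul, ih (i + 1) j (by omega),
        ih i (j + 1) (by omega), mul_zero, add_zero, sub_zero] at h1
      exact (mul_eq_zero.1 h1).resolve_left (pow_ne_zero 3 hm)
  exact fun i j => key (2 * q + 1) i j (by omega)

theorem residueFree_prod (q N : ℕ) (H : ℕ → ℝ⟦X⟧⟦X⟧)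
    (hH : ∀ m, H m * (PowerSeries.C (PowerSeries.C ((m + 1 : ℝ) ^ 3)) +
      PowerSeries.C (PowerSeries.C (m + 1 : ℝ)) * symmTwo - symmThree) = 1) :
    ResidueFree q (∏ m ∈ range N, (H m * (PowerSeries.C (PowerSeries.C ((m + 1 : ℝ) ^ 3)) +
      PowerSeries.C (PowerSeries.C (m + 1 : ℝ)) * symmTwo + symmThree))) := by
  induction N with
  | zero => simpa using residueFree_one q
  | succ N ih =>
    rw [prod_range_succ, ← mul_assoc]
    refine ResidueFree.mul_num (ResidueFree.of_mul_den (m := (N + 1 : ℝ)) (by positivity) ?_) _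
    rw [mul_assoc, hH, mul_one]
    exact ih

end DiagonalCoefficients

/-! ### Partial fractions over a domain. -/

section PartialFractions

open PowerSeries

theorem coeff_eq_of_mul_X_sub_C {R : Type*} [CommRing R] {x v : R} (hv : v * x = 1) {G : R⟦X⟧}
    (hG : G * (X - PowerSeries.C x) = 1) (k : ℕ) : coeff k G = -v ^ (k + 1) := by
  have h : G * (X - PowerSeries.C x) = G * X - PowerSeries.C x * G := by ring
  rw [h] at hG
  induction k with
  | zero =>
    have h0 := congrArg (coeff 0) hG
    rw [map_sub, coeff_C_mul, coeff_zero_mul_X, coeff_zero_one] at h0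
    linear_combination (-v) * h0 - coeff 0 G * hv
  | succ k ih =>
    have h0 := congrArg (coeff (k + 1)) hG
    rw [map_sub, coeff_C_mul, coeff_succ_mul_X, coeff_one, if_neg (by omega), ih] at h0
    linear_combination (-v) * h0 - coeff (k + 1) G * hv

/-- The coefficient of `x ^ q` of `f / ∏ (x - xₙ)` is minus the sum of the residues of
`f / (x ^ (q + 1) ∏ (x - xₙ))` at the points `xₙ` if the residue at infinity vanishes. -/
theorem coeff_mul_inv_prod_X_sub_C {R ι : Type*} [CommRing R] [IsDomain R] [DecidableEq ι]
    (S : Finset ι) (x w v : ι → R)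
    (hw : ∀ n ∈ S, w n * ∏ m ∈ S.erase n, (x n - x m) = 1) (hv : ∀ n ∈ S, v n * x n = 1)
    (f : Polynomial R) (q : ℕ) (hq : 0 < q) (hf : f.natDegree < S.card + q) (G : R⟦X⟧)
    (hG : G * ∏ n ∈ S, (X - PowerSeries.C (x n)) = 1) :
    coeff q ((f : R⟦X⟧) * G) = -∑ n ∈ S, f.eval (x n) * w n * v n ^ (q + 1) := by
  classical
  -- The points are distinct, since otherwise the product inverted by `w n` would be zero.
  have hinj : Set.InjOn x S := by
    intro n hn m hm hnm
    by_contra hne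
    have h := hw n hn
    rw [prod_eq_zero (mem_erase.2 ⟨fun h => hne h.symm, hm⟩) (sub_eq_zero.2 hnm), mul_zero] at h
    exact zero_ne_one h
  let P : Polynomial R := ∏ n ∈ S, (Polynomial.X - Polynomial.C (x n))
  have hP : P.Monic := Polynomial.monic_prod_of_monic _ _ fun n _ => Polynomial.monic_X_sub_C _
  have hPd : P.natDegree = S.card := by
    rw [Polynomial.natDegree_prod_of_monic _ _ fun n _ => Polynomial.monic_X_sub_C _]
    simp
  have hP0 : ∀ n ∈ S, P.eval (x n) = 0 := fun n hn => by
    rw [Polynomial.eval_prod, prod_eq_zero hn]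
    simp
  -- Lagrange interpolation: the remainder modulo P is determined by the values of f at the roots.
  have hrem : f %ₘ P = ∑ n ∈ S, Polynomial.C (f.eval (x n) * w n) *
      ∏ m ∈ S.erase n, (Polynomial.X - Polynomial.C (x m)) := by
    refine Polynomial.eq_of_degrees_lt_of_eval_index_eq S hinj ?_ ?_ ?_
    · have := Polynomial.degree_modByMonic_lt f hP
      rwa [Polynomial.degree_eq_natDegree hP.ne_zero, hPd] at this
    · refine (Polynomial.degree_sum_le _ _).trans_lt ?_
      rw [Finset.sup_lt_iff (WithBot.bot_lt_coe _)]
      intro n hn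
      rw [← Polynomial.smul_eq_C_mul]
      refine (Polynomial.degree_smul_le _ _).trans_lt ?_
      rw [Polynomial.degree_eq_natDegree (Polynomial.monic_prod_of_monic _ _
        fun n _ => Polynomial.monic_X_sub_C _).ne_zero,
        Polynomial.natDegree_prod_of_monic _ _ fun n _ => Polynomial.monic_X_sub_C _]
      simp only [Polynomial.natDegree_X_sub_C, sum_const, smul_eq_mul, mul_one]
      exact_mod_cast card_erase_lt_of_mem hn
    · intro n hn
      have h1 := congrArg (Polynomial.eval (x n)) (Polynomial.modByMonic_add_div f P)
      rw [Polynomial.eval_add, Polynomial.eval_mul, hP0 n hn, zero_mul, add_zero] at h1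
      rw [h1, Polynomial.eval_finsetSum, sum_eq_single_of_mem n hn]
      · rw [Polynomial.eval_mul, Polynomial.eval_C, Polynomial.eval_prod]
        simp only [Polynomial.eval_sub, Polynomial.eval_X, Polynomial.eval_C]
        rw [mul_assoc, hw n hn, mul_one]
      · intro m hm hmn
        rw [Polynomial.eval_mul, Polynomial.eval_prod,
          prod_eq_zero (mem_erase.2 ⟨hmn.symm, hn⟩), mul_zero]
        simp
  have hcoe (T : Finset ι) : ((∏ n ∈ T, (Polynomial.X - Polynomial.C (x n)) : Polynomial R) : R⟦X⟧) =
      ∏ n ∈ T, (X - PowerSeries.C (x n)) := by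
    rw [← Polynomial.coeToPowerSeries.ringHom_apply, map_prod]
    simp
  have hf' : (f : R⟦X⟧) * G = ((f /ₘ P : Polynomial R) : R⟦X⟧) +
      ∑ n ∈ S, PowerSeries.C (f.eval (x n) * w n) *
        (G * ∏ m ∈ S.erase n, (X - PowerSeries.C (x m))) := by
    have h2 (g : ι → Polynomial R) : ((∑ n ∈ S, g n : Polynomial R) : R⟦X⟧) =
        ∑ n ∈ S, (g n : R⟦X⟧) := by
      rw [← Polynomial.coeToPowerSeries.ringHom_apply, map_sum]
      rfl
    have h1 : (f : R⟦X⟧) = ((f %ₘ P + P * (f /ₘ P) : Polynomial R) : R⟦X⟧) := by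
      rw [Polynomial.modByMonic_add_div f P]
    rw [h1, Polynomial.coe_add, Polynomial.coe_mul, hcoe S, hrem, add_mul, add_comm, h2, sum_mul]
    congr 1
    · linear_combination ((f /ₘ P : Polynomial R) : R⟦X⟧) * hG
    · refine sum_congr rfl fun n _ => ?_
      rw [Polynomial.coe_mul, hcoe, Polynomial.coe_C]
      ring
  rw [hf', map_add, Polynomial.coeff_coe, Polynomial.coeff_eq_zero_of_natDegree_lt, zero_add,
    map_sum, ← sum_neg_distrib]
  · refine sum_congr rfl fun n hn => ?_
    rw [coeff_C_mul, coeff_eq_of_mul_X_sub_C (hv n hn), mul_neg]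
    rw [mul_assoc, prod_erase_mul _ _ hn, hG]
  -- The quotient has degree less than q, so it does not reach x^q. This is where the residue at
  -- infinity vanishes.
  · rw [Polynomial.natDegree_divByMonic _ hP, hPd]
    omega

end PartialFractions

end Virasoro

/-! ### Poles and residues of the truncated Virasoro function. -/

namespace Virasoro

open Finset PowerSeries

/-- The power series `1 + c t`. -/
noncomputable def lin (c : ℝ) : ℝ⟦X⟧ := 1 + PowerSeries.C c * X

theorem constantCoeff_lin (c : ℝ) : constantCoeff (lin c) = 1 := by simp [lin]

theorem lin_mul_inv (c : ℝ) : lin c * (lin c)⁻¹ = 1 :=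
  PowerSeries.mul_inv_cancel _ (by simp [constantCoeff_lin])

theorem rescale_lin (a c : ℝ) : rescale a (lin c) = lin (a * c) := by
  rw [lin, lin, map_add, map_one, map_mul, rescale_X]
  have : rescale a (PowerSeries.C c : ℝ⟦X⟧) = PowerSeries.C c := by
    ext i
    rw [coeff_rescale, coeff_C]
    split_ifs with h
    · simp [h]
    · simp
  rw [this, mul_comm a c, map_mul]
  ring

/-- The pole `x = -n (n + t)` for `n` replaced by `n + 1`. -/
noncomputable def pole (n : ℕ) : ℝ⟦X⟧ :=
  -(PowerSeries.C ((n + 1 : ℝ) ^ 2) * lin ((n + 1 : ℝ)⁻¹))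

theorem pole_eq (n : ℕ) :
    pole n = -(PowerSeries.C (n + 1 : ℝ) ^ 2 + PowerSeries.C (n + 1 : ℝ) * X) := by
  have h : PowerSeries.C (n + 1 : ℝ) * PowerSeries.C ((n + 1 : ℝ)⁻¹) = 1 := by
    rw [← map_mul, mul_inv_cancel₀ (by positivity), map_one]
  rw [pole, lin, map_pow]
  linear_combination (-PowerSeries.C (n + 1 : ℝ) * X) * h

theorem C_mul_lin_neg_inv (c : ℝ) (hc : c ≠ 0) :
    PowerSeries.C c * lin (-c⁻¹) = PowerSeries.C c - X := by
  have h : PowerSeries.C c * PowerSeries.C c⁻¹ = 1 := by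
    rw [← map_mul, mul_inv_cancel₀ hc, map_one]
  rw [lin, map_neg]
  linear_combination (-X) * h

theorem C_mul_lin_inv (c : ℝ) (hc : c ≠ 0) :
    PowerSeries.C c * lin c⁻¹ = PowerSeries.C c + X := by
  have h : PowerSeries.C c * PowerSeries.C c⁻¹ = 1 := by
    rw [← map_mul, mul_inv_cancel₀ hc, map_one]
  rw [lin]
  linear_combination X * h

theorem pole_sub_pole (n m : ℕ) :
    pole n - pole m = PowerSeries.C (((m : ℝ) - n) * (m + n + 2)) * lin (m + n + 2 : ℝ)⁻¹ := by
  rw [map_mul, mul_assoc, C_mul_lin_inv _ (by positivity), pole_eq, pole_eq]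
  simp only [map_add, map_sub, map_one, map_ofNat]
  ring

theorem pole_add {n m : ℕ} (h : m ≠ n) :
    pole n + PowerSeries.C ((m + 1 : ℝ) ^ 2) * lin (-(m + 1 : ℝ)⁻¹) =
      PowerSeries.C (((m : ℝ) - n) * (m + n + 2)) * lin (-((m : ℝ) - n)⁻¹) := by
  have hmn : (m : ℝ) - n ≠ 0 := sub_ne_zero.2 (by exact_mod_cast h)
  rw [mul_comm ((m : ℝ) - n), map_mul, mul_assoc, C_mul_lin_neg_inv _ hmn, sq, map_mul, mul_assoc,
    C_mul_lin_neg_inv _ (by positivity), pole_eq]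
  simp only [map_add, map_sub, map_one, map_ofNat]
  ring

theorem pole_add_self (n : ℕ) :
    pole n + PowerSeries.C ((n + 1 : ℝ) ^ 2) * lin (-(n + 1 : ℝ)⁻¹) =
      PowerSeries.C (-2 * (n + 1 : ℝ)) * X := by
  rw [sq, map_mul, mul_assoc, C_mul_lin_neg_inv _ (by positivity), pole_eq]
  simp only [map_add, map_mul, map_neg, map_one, map_ofNat]
  ring

/-- The inverse of `∏_{m ≠ n} (xₙ - xₘ)`. -/
noncomputable def poleWeight (N n : ℕ) : ℝ⟦X⟧ :=
  ∏ m ∈ (range N).erase n, (PowerSeries.C ((((m : ℝ) - n) * (m + n + 2))⁻¹) *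
    (lin (m + n + 2 : ℝ)⁻¹)⁻¹)

theorem poleWeight_mul (N n : ℕ) :
    poleWeight N n * ∏ m ∈ (range N).erase n, (pole n - pole m) = 1 := by
  rw [poleWeight, ← prod_mul_distrib]
  refine prod_eq_one fun m hm => ?_
  have hmn : (m : ℝ) - n ≠ 0 := sub_ne_zero.2 (by exact_mod_cast ne_of_mem_erase hm)
  have h0 : ((m : ℝ) - n) * (m + n + 2) ≠ 0 := mul_ne_zero hmn (by positivity)
  have h1 : PowerSeries.C ((((m : ℝ) - n) * (m + n + 2))⁻¹) *
      PowerSeries.C (((m : ℝ) - n) * (m + n + 2)) = 1 := by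
    rw [← map_mul, inv_mul_cancel₀ h0, map_one]
  rw [pole_sub_pole]
  linear_combination h1 * (lin (m + n + 2 : ℝ)⁻¹ * (lin (m + n + 2 : ℝ)⁻¹)⁻¹) +
    lin_mul_inv (m + n + 2 : ℝ)⁻¹

/-- The inverse of the pole `xₙ`. -/
noncomputable def poleInv (n : ℕ) : ℝ⟦X⟧ :=
  PowerSeries.C (-((n + 1 : ℝ) ^ 2)⁻¹) * (lin (n + 1 : ℝ)⁻¹)⁻¹

theorem poleInv_mul (n : ℕ) : poleInv n * pole n = 1 := by
  have h1 : PowerSeries.C (((n + 1 : ℝ) ^ 2)⁻¹) * PowerSeries.C ((n + 1 : ℝ) ^ 2) = 1 := by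
    rw [← map_mul, inv_mul_cancel₀ (by positivity), map_one]
  rw [poleInv, pole, map_neg]
  linear_combination h1 * (lin (n + 1 : ℝ)⁻¹ * (lin (n + 1 : ℝ)⁻¹)⁻¹) + lin_mul_inv (n + 1 : ℝ)⁻¹

/-- The numerator of the truncated Virasoro function, times the Jacobian form, as a polynomial
in `x` over `ℝ⟦t⟧`. -/
noncomputable def numPoly (α N : ℕ) : Polynomial ℝ⟦X⟧ :=
  (∏ m ∈ range N, (Polynomial.C (lin (m + 1 : ℝ)⁻¹ * (lin (-(m + 1 : ℝ)⁻¹))⁻¹) *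
    (Polynomial.X + Polynomial.C (PowerSeries.C ((m + 1 : ℝ) ^ 2) * lin (-(m + 1 : ℝ)⁻¹))))) *
  ((Polynomial.X - Polynomial.C (X ^ 2)) ^ α * (Polynomial.X + Polynomial.C (2 * X ^ 2)))

theorem natDegree_numPoly_le (α N : ℕ) : (numPoly α N).natDegree ≤ N + (α + 1) := by
  have h1 (c d : ℝ⟦X⟧) : (Polynomial.C c * (Polynomial.X + Polynomial.C d)).natDegree ≤ 1 :=
    (Polynomial.natDegree_C_mul_le _ _).trans (Polynomial.natDegree_X_add_C d).le
  refine Polynomial.natDegree_mul_le.trans (add_le_add ?_ ?_)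
  · refine (Polynomial.natDegree_prod_le _ _).trans ?_
    refine (sum_le_sum fun m _ => h1 _ _).trans ?_
    simp
  · refine Polynomial.natDegree_mul_le.trans (add_le_add ?_ ?_)
    · refine Polynomial.natDegree_pow_le.trans ?_
      rw [Polynomial.natDegree_X_sub_C, mul_one]
    · rw [Polynomial.natDegree_X_add_C]

/-- The right side is (m-s)(m-t)(m-u), with m + 1 in the role of m. For s + t + u = 0 and x = su the
factors in s and u combine to (m-s)(m-u) = x + m(m + t), which locates the pole. -/
theorem C_C_mul_C_lin_mul (m : ℕ) :
    PowerSeries.C (PowerSeries.C (m + 1 : ℝ)) * PowerSeries.C (lin (-(m + 1 : ℝ)⁻¹)) *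
      (X - PowerSeries.C (pole m)) =
    PowerSeries.C (PowerSeries.C ((m + 1 : ℝ) ^ 3)) +
      PowerSeries.C (PowerSeries.C (m + 1 : ℝ)) * symmTwo - symmThree := by
  rw [← map_mul, C_mul_lin_neg_inv _ (by positivity), pole_eq, symmTwo, symmThree, varT]
  simp only [map_sub, map_neg, map_add, map_mul, map_pow, map_one]
  ring

/-- The companion factorization uses (m+s)(m+u) = x + m(m - t). -/
theorem C_C_mul_C_lin_mul_add (m : ℕ) :
    PowerSeries.C (PowerSeries.C (m + 1 : ℝ)) * PowerSeries.C (lin (m + 1 : ℝ)⁻¹) *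
      (X + PowerSeries.C (PowerSeries.C ((m + 1 : ℝ) ^ 2) * lin (-(m + 1 : ℝ)⁻¹))) =
    PowerSeries.C (PowerSeries.C ((m + 1 : ℝ) ^ 3)) +
      PowerSeries.C (PowerSeries.C (m + 1 : ℝ)) * symmTwo + symmThree := by
  have h : PowerSeries.C ((m + 1 : ℝ) ^ 2) * lin (-(m + 1 : ℝ)⁻¹) =
      PowerSeries.C (m + 1 : ℝ) * (PowerSeries.C (m + 1 : ℝ) - X) := by
    rw [sq, map_mul, mul_assoc, C_mul_lin_neg_inv _ (by positivity)]
  rw [← map_mul, C_mul_lin_inv _ (by positivity), h, symmTwo, symmThree, varT]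
  simp only [map_sub, map_add, map_mul, map_pow, map_one]
  ring

/-- The coefficient of x^q t^q is computed in two ways: it vanishes by `residueFree_prod`, and it is
a sum of residues by partial fractions. The numerator has degree at most N + α + 1, so α + 1 < q is
the degree condition needed there. -/
theorem coeff_sum_residues (α N q : ℕ) (hq : α + 1 < q) :
    coeff q (∑ n ∈ range N, (numPoly α N).eval (pole n) * poleWeight N n * poleInv n ^ (q + 1)) =
      0 := by
  have hg : ∀ n, ∃ g : ℝ⟦X⟧⟦X⟧, g * (X - PowerSeries.C (pole n)) = 1 := fun n => by
    have : IsUnit (X - PowerSeries.C (pole n) : ℝ⟦X⟧⟦X⟧) := by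
      rw [isUnit_iff_constantCoeff]
      simp only [map_sub, constantCoeff_X, constantCoeff_C, zero_sub, IsUnit.neg_iff]
      exact IsUnit.of_mul_eq_one_right _ (poleInv_mul n)
    exact this.exists_left_inv
  choose g hg using hg
  have h1 := coeff_mul_inv_prod_X_sub_C (range N) pole (poleWeight N) poleInv
    (fun n _ => poleWeight_mul N n) (fun n _ => poleInv_mul n) (numPoly α N) q (by omega)
    (by have := natDegree_numPoly_le α N; rw [card_range]; omega) (∏ n ∈ range N, g n)
    (by rw [← prod_mul_distrib]; exact prod_eq_one fun n _ => hg n)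
  let H : ℕ → ℝ⟦X⟧⟦X⟧ := fun m => PowerSeries.C (PowerSeries.C (m + 1 : ℝ)⁻¹) *
    PowerSeries.C (lin (-(m + 1 : ℝ)⁻¹))⁻¹ * g m
  have hc (m : ℕ) : PowerSeries.C (PowerSeries.C (m + 1 : ℝ)⁻¹) *
      PowerSeries.C (PowerSeries.C (m + 1 : ℝ)) = (1 : ℝ⟦X⟧⟦X⟧) := by
    rw [← map_mul, ← map_mul, inv_mul_cancel₀ (by positivity), map_one, map_one]
  have hl (m : ℕ) : PowerSeries.C (lin (-(m + 1 : ℝ)⁻¹)) * PowerSeries.C (lin (-(m + 1 : ℝ)⁻¹))⁻¹ =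
      (1 : ℝ⟦X⟧⟦X⟧) := by
    rw [← map_mul, lin_mul_inv, map_one]
  have hH : ∀ m, H m * (PowerSeries.C (PowerSeries.C ((m + 1 : ℝ) ^ 3)) +
      PowerSeries.C (PowerSeries.C (m + 1 : ℝ)) * symmTwo - symmThree) = 1 := fun m => by
    rw [← C_C_mul_C_lin_mul]
    simp only [H]
    linear_combination (PowerSeries.C (lin (-(m + 1 : ℝ)⁻¹)) *
      PowerSeries.C (lin (-(m + 1 : ℝ)⁻¹))⁻¹ * (g m * (X - PowerSeries.C (pole m)))) * hc m +
      (g m * (X - PowerSeries.C (pole m))) * hl m + hg m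
  have h2 := residueFree_prod q N H hH α 0
  have h3 : symmTwo ^ α * symmThree ^ 0 * (X + 2 * varT ^ 2) *
      ∏ m ∈ range N, (H m * (PowerSeries.C (PowerSeries.C ((m + 1 : ℝ) ^ 3)) +
        PowerSeries.C (PowerSeries.C (m + 1 : ℝ)) * symmTwo + symmThree)) =
      (numPoly α N : ℝ⟦X⟧⟦X⟧) * ∏ n ∈ range N, g n := by
    have h4 : (numPoly α N : ℝ⟦X⟧⟦X⟧) = (∏ m ∈ range N,
        (PowerSeries.C (lin (m + 1 : ℝ)⁻¹ * (lin (-(m + 1 : ℝ)⁻¹))⁻¹) *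
        (X + PowerSeries.C (PowerSeries.C ((m + 1 : ℝ) ^ 2) * lin (-(m + 1 : ℝ)⁻¹))))) *
        ((X - PowerSeries.C (X ^ 2)) ^ α * (X + PowerSeries.C (2 * X ^ 2))) := by
      rw [numPoly, ← Polynomial.coeToPowerSeries.ringHom_apply, map_mul, map_prod, map_mul, map_pow]
      simp only [Polynomial.coeToPowerSeries.ringHom_apply, Polynomial.coe_mul, Polynomial.coe_add,
        Polynomial.coe_sub, Polynomial.coe_C, Polynomial.coe_X]
    have h5 : ∏ m ∈ range N, (H m * (PowerSeries.C (PowerSeries.C ((m + 1 : ℝ) ^ 3)) +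
        PowerSeries.C (PowerSeries.C (m + 1 : ℝ)) * symmTwo + symmThree)) = (∏ m ∈ range N,
        (PowerSeries.C (lin (m + 1 : ℝ)⁻¹ * (lin (-(m + 1 : ℝ)⁻¹))⁻¹) *
        (X + PowerSeries.C (PowerSeries.C ((m + 1 : ℝ) ^ 2) * lin (-(m + 1 : ℝ)⁻¹))))) *
        ∏ n ∈ range N, g n := by
      rw [← prod_mul_distrib]
      refine prod_congr rfl fun m _ => ?_
      rw [← C_C_mul_C_lin_mul_add, map_mul (PowerSeries.C : ℝ⟦X⟧ →+* ℝ⟦X⟧⟦X⟧) (lin _)]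
      simp only [H]
      linear_combination (PowerSeries.C (lin (-(m + 1 : ℝ)⁻¹))⁻¹ * PowerSeries.C (lin (m + 1 : ℝ)⁻¹) *
        g m * (X + PowerSeries.C (PowerSeries.C ((m + 1 : ℝ) ^ 2) * lin (-(m + 1 : ℝ)⁻¹)))) * hc m
    rw [h4, h5, symmTwo, varT, map_pow, map_mul, map_pow, map_ofNat]
    ring
  rw [h3, bicoeff_apply, h1, map_neg, neg_eq_zero] at h2
  exact h2

theorem prod_erase_range {M : Type*} [CommMonoid M] (n l : ℕ) (g : ℕ → M) :
    ∏ m ∈ (range (n + 1 + l)).erase n, g m =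
      (∏ m ∈ range n, g m) * ∏ j ∈ range l, g (n + 1 + j) := by
  have h : (range (n + 1 + l)).erase n = range n ∪ (range l).map (addLeftEmbedding (n + 1)) := by
    ext i
    simp only [mem_erase, mem_range, mem_union, mem_map, addLeftEmbedding_apply]
    constructor
    · rintro ⟨h1, h2⟩
      rcases lt_or_gt_of_ne h1 with h | h
      · exact Or.inl h
      · exact Or.inr ⟨i - (n + 1), by omega, by omega⟩
    · rintro (h | ⟨j, hj, rfl⟩) <;> omega
  rw [h, prod_union, prod_map]
  · rfl
  · rw [disjoint_left]
    simp only [mem_range, mem_map, addLeftEmbedding_apply, not_exists, not_and]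
    intros
    omega

/-- Both sides are the product of 1 + t/k over 1 ≤ k ≤ N + n + 1, cut at N and at n + 1. -/
theorem prod_lin_mul_prod_lin_shift (n N : ℕ) :
    (∏ m ∈ range N, lin (m + 1 : ℝ)⁻¹) * ∏ j ∈ range (n + 1), lin ((N + j + 1 : ℝ)⁻¹) =
      (∏ m ∈ range n, lin (m + 1 : ℝ)⁻¹) * lin (n + 1 : ℝ)⁻¹ *
        ∏ m ∈ range N, lin (m + n + 2 : ℝ)⁻¹ := by
  have h1 := prod_range_add (fun m : ℕ => lin (m + 1 : ℝ)⁻¹) N (n + 1)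
  have h2 := prod_range_add (fun m : ℕ => lin (m + 1 : ℝ)⁻¹) (n + 1) N
  rw [add_comm, h1, prod_range_succ (fun m : ℕ => lin (m + 1 : ℝ)⁻¹) n] at h2
  push_cast at h2
  rw [h2]
  congr 1
  refine prod_congr rfl fun m _ => ?_
  congr 2
  ring

/-- The indices m < n contribute 1 + t/k for k ≤ n, and those m > n contribute 1 - t/k for k ≤ l.
The second product on the left supplies the missing k from l + 1 to l + n + 1. -/
theorem prod_erase_lin (n l : ℕ) :
    (∏ m ∈ (range (n + 1 + l)).erase n, lin (-((m : ℝ) - n)⁻¹)) *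
      ∏ j ∈ range (n + 1), lin (-(l + j + 1 : ℝ)⁻¹) =
    (∏ m ∈ range n, lin (m + 1 : ℝ)⁻¹) * ∏ m ∈ range (n + 1 + l), lin (-(m + 1 : ℝ)⁻¹) := by
  have h1 := prod_range_add (fun m : ℕ => lin (-(m + 1 : ℝ)⁻¹)) l (n + 1)
  push_cast at h1
  rw [prod_erase_range, ← prod_range_reflect, add_comm (n + 1) l, h1, mul_assoc]
  congr 1
  · refine prod_congr rfl fun m hm => ?_
    have hm' := mem_range.1 hm
    congr 1
    rw [← inv_neg]
    congr 1
    rw [Nat.cast_sub (by omega), Nat.cast_sub (by omega)]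
    push_cast
    ring
  · congr 1
    refine prod_congr rfl fun j _ => ?_
    congr 3
    push_cast
    ring

/-- All dependence on the truncation sits in two boundary products of n + 1 factors each.
Multiplying by them leaves an expression free of l. The simple zero in t comes from the numerator
factor m = n (`pole_add_self`). -/
theorem prod_residue (n l : ℕ) :
    (∏ m ∈ range (n + 1 + l), (lin (m + 1 : ℝ)⁻¹ * (lin (-(m + 1 : ℝ)⁻¹))⁻¹ *
      (pole n + PowerSeries.C ((m + 1 : ℝ) ^ 2) * lin (-(m + 1 : ℝ)⁻¹)))) *
      poleWeight (n + 1 + l) n *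
      ((∏ j ∈ range (n + 1), lin (((n + 1 + l : ℕ) + j + 1 : ℝ)⁻¹)) *
        ∏ j ∈ range (n + 1), lin (-(l + j + 1 : ℝ)⁻¹)) =
    PowerSeries.C (-2 * (n + 1 : ℝ)) * X * lin (n + n + 2 : ℝ)⁻¹ * lin (n + 1 : ℝ)⁻¹ *
      (∏ m ∈ range n, lin (m + 1 : ℝ)⁻¹) ^ 2 := by
  have hn : n ∈ range (n + 1 + l) := mem_range.2 (by omega)
  have h1 := prod_lin_mul_prod_lin_shift n (n + 1 + l)
  have h2 := prod_erase_lin n l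
  have h3 : (∏ m ∈ range (n + 1 + l), (lin (-(m + 1 : ℝ)⁻¹))⁻¹) *
      ∏ m ∈ range (n + 1 + l), lin (-(m + 1 : ℝ)⁻¹) = 1 := by
    rw [← prod_mul_distrib]
    exact prod_eq_one fun m _ => by rw [mul_comm, lin_mul_inv]
  have h4 : (∏ m ∈ range (n + 1 + l), lin (m + n + 2 : ℝ)⁻¹) *
      ∏ m ∈ (range (n + 1 + l)).erase n, (lin (m + n + 2 : ℝ)⁻¹)⁻¹ = lin (n + n + 2 : ℝ)⁻¹ := by
    rw [← mul_prod_erase _ _ hn, mul_assoc, ← prod_mul_distrib,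
      prod_eq_one fun m _ => lin_mul_inv _, mul_one]
  have h5 : (∏ m ∈ range (n + 1 + l),
      (pole n + PowerSeries.C ((m + 1 : ℝ) ^ 2) * lin (-(m + 1 : ℝ)⁻¹))) * poleWeight (n + 1 + l) n =
      PowerSeries.C (-2 * (n + 1 : ℝ)) * X *
        ((∏ m ∈ (range (n + 1 + l)).erase n, lin (-((m : ℝ) - n)⁻¹)) *
          ∏ m ∈ (range (n + 1 + l)).erase n, (lin (m + n + 2 : ℝ)⁻¹)⁻¹) := by
    rw [← mul_prod_erase _ _ hn, pole_add_self, poleWeight, mul_assoc, ← prod_mul_distrib,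
      ← prod_mul_distrib]
    congr 1
    refine prod_congr rfl fun m hm => ?_
    have hmn : (m : ℝ) - n ≠ 0 := sub_ne_zero.2 (by exact_mod_cast ne_of_mem_erase hm)
    have h0 : ((m : ℝ) - n) * (m + n + 2) ≠ 0 := mul_ne_zero hmn (by positivity)
    have h1 : PowerSeries.C ((((m : ℝ) - n) * (m + n + 2))⁻¹) *
        PowerSeries.C (((m : ℝ) - n) * (m + n + 2)) = 1 := by
      rw [← map_mul, inv_mul_cancel₀ h0, map_one]
    rw [pole_add (ne_of_mem_erase hm)]
    linear_combination (lin (-((m : ℝ) - n)⁻¹) * (lin (m + n + 2 : ℝ)⁻¹)⁻¹) * h1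
  rw [prod_mul_distrib, prod_mul_distrib]
  generalize ∏ m ∈ range (n + 1 + l), lin (m + 1 : ℝ)⁻¹ = A at *
  generalize ∏ m ∈ range (n + 1 + l), (lin (-(m + 1 : ℝ)⁻¹))⁻¹ = B at *
  generalize ∏ m ∈ range (n + 1 + l), lin (-(m + 1 : ℝ)⁻¹) = B' at *
  generalize ∏ m ∈ range (n + 1 + l),
      (pole n + PowerSeries.C ((m + 1 : ℝ) ^ 2) * lin (-(m + 1 : ℝ)⁻¹)) = E at *
  generalize poleWeight (n + 1 + l) n = W at *
  generalize ∏ j ∈ range (n + 1), lin (((n + 1 + l : ℕ) + j + 1 : ℝ)⁻¹) = D₁ at *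
  generalize ∏ j ∈ range (n + 1), lin (-(l + j + 1 : ℝ)⁻¹) = D₂ at *
  generalize ∏ m ∈ range (n + 1 + l), lin (m + n + 2 : ℝ)⁻¹ = M at *
  generalize ∏ m ∈ (range (n + 1 + l)).erase n, (lin (m + n + 2 : ℝ)⁻¹)⁻¹ = M' at *
  generalize ∏ m ∈ (range (n + 1 + l)).erase n, lin (-((m : ℝ) - n)⁻¹) = F at *
  generalize ∏ m ∈ range n, lin (m + 1 : ℝ)⁻¹ = K at *
  generalize PowerSeries.C (-2 * (n + 1 : ℝ)) * X = c at *
  calc A * B * E * W * (D₁ * D₂) = (A * D₁) * B * D₂ * (E * W) := by ring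
    _ = (K * lin (n + 1 : ℝ)⁻¹ * M) * B * D₂ * (c * (F * M')) := by rw [h1, h5]
    _ = K * lin (n + 1 : ℝ)⁻¹ * (M * M') * B * c * (F * D₂) := by ring
    _ = K * lin (n + 1 : ℝ)⁻¹ * lin (n + n + 2 : ℝ)⁻¹ * c * K * (B * B') := by
        rw [h4, h2]; ring
    _ = _ := by rw [h3]; ring

end Virasoro

/-! ### Comparison of the residues with the terms of e, and the limit. -/

namespace Virasoro

open Finset PowerSeries Filter Topology

/-- The inverse of the correction factor that relates the residues of the truncated Virasoro
function at `n` to their limits. -/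
noncomputable def corrSeries (n l : ℕ) : ℝ⟦X⟧ :=
  ∏ j ∈ range (n + 1), ((lin (-(n + 1 : ℝ) * ((n + 1 + l : ℕ) + j + 1 : ℝ)⁻¹))⁻¹ *
    (lin (-(n + 1 : ℝ) * -(l + j + 1 : ℝ)⁻¹))⁻¹)

theorem rescale_C (a c : ℝ) : rescale a (PowerSeries.C c : ℝ⟦X⟧) = PowerSeries.C c := by
  ext i
  rw [coeff_rescale, coeff_C]
  split_ifs with h
  · simp [h]
  · simp

theorem lin_neg_one : lin (-1) = 1 - X := by
  rw [lin, map_neg, map_one]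
  ring

theorem invOneSubPow_val_eq_pow (q : ℕ) : (invOneSubPow ℝ q).val = ((lin (-1))⁻¹) ^ q := by
  have h1 : (invOneSubPow ℝ q).val * (1 - X) ^ q = 1 := by
    rw [← invOneSubPow_inv_eq_one_sub_pow]
    exact (invOneSubPow ℝ q).val_inv
  have h2 : lin (-1) ^ q * ((lin (-1))⁻¹) ^ q = 1 := by
    rw [← mul_pow, lin_mul_inv, one_pow]
  rw [← lin_neg_one] at h1
  linear_combination (-(invOneSubPow ℝ q).val) * h2 + ((lin (-1))⁻¹) ^ q * h1

theorem two_add_X_sub_sq :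
    (2 + (X - X ^ 2) : ℝ⟦X⟧) = PowerSeries.C 2 * (lin (-(1 / 2)) * lin 1) := by
  have h : (2 : ℝ⟦X⟧) * PowerSeries.C (1 / 2) = 1 := by
    rw [show (2 : ℝ⟦X⟧) = PowerSeries.C 2 from rfl, ← map_mul]
    norm_num
  rw [lin, lin, map_neg, map_one, show PowerSeries.C 2 = (2 : ℝ⟦X⟧) from rfl]
  linear_combination (X + X ^ 2) * h

/-- Let ν = n + 1. Under t = -νX the pole becomes -ν²(1 - X), x - t² becomes -ν²(1 - (X - X²)), and
x + 2t² becomes -ν²(1 + X)(1 - 2X). Together with 2 + X - X² = (2 - X)(1 + X) these are the factors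
of `termSeries`. -/
theorem rescale_residue (α q n l : ℕ) :
    rescale (-(n + 1 : ℝ)) ((numPoly α (n + 1 + l)).eval (pole n) * poleWeight (n + 1 + l) n *
      poleInv n ^ (q + 1 + 1)) =
    PowerSeries.C ((n + 1 : ℝ) ^ 2 * (-(n + 1 : ℝ) ^ 2) ^ (α + 1) *
      (-((n + 1 : ℝ) ^ 2)⁻¹) ^ (q + 1 + 1)) *
      (X * (termSeries α q n * corrSeries n l)) := by
  set ρ : ℝ⟦X⟧ →+* ℝ⟦X⟧ := rescale (-(n + 1 : ℝ)) with hρ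
  have hν : (n + 1 : ℝ) ≠ 0 := by positivity
  have heval : (numPoly α (n + 1 + l)).eval (pole n) =
      (∏ m ∈ range (n + 1 + l), (lin (m + 1 : ℝ)⁻¹ * (lin (-(m + 1 : ℝ)⁻¹))⁻¹ *
      (pole n + PowerSeries.C ((m + 1 : ℝ) ^ 2) * lin (-(m + 1 : ℝ)⁻¹)))) *
      ((pole n - X ^ 2) ^ α * (pole n + 2 * X ^ 2)) := by
    rw [numPoly, Polynomial.eval_mul, Polynomial.eval_prod]
    simp only [Polynomial.eval_mul, Polynomial.eval_pow, Polynomial.eval_sub, Polynomial.eval_add,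
      Polynomial.eval_X, Polynomial.eval_C]
  have h1 := congrArg ρ (prod_residue n l)
  generalize ∏ m ∈ range (n + 1 + l), (lin (m + 1 : ℝ)⁻¹ * (lin (-(m + 1 : ℝ)⁻¹))⁻¹ *
      (pole n + PowerSeries.C ((m + 1 : ℝ) ^ 2) * lin (-(m + 1 : ℝ)⁻¹))) = P₀ at h1 heval
  have hcorr : ρ ((∏ j ∈ range (n + 1), lin (((n + 1 + l : ℕ) + j + 1 : ℝ)⁻¹)) *
        ∏ j ∈ range (n + 1), lin (-(l + j + 1 : ℝ)⁻¹)) * corrSeries n l = 1 := by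
    rw [← prod_mul_distrib, map_prod, corrSeries, ← prod_mul_distrib]
    refine prod_eq_one fun j _ => ?_
    rw [map_mul, hρ, rescale_lin, rescale_lin]
    have e1 := lin_mul_inv (-(n + 1 : ℝ) * ((n + 1 + l : ℕ) + j + 1 : ℝ)⁻¹)
    have e2 := lin_mul_inv (-(n + 1 : ℝ) * -(l + j + 1 : ℝ)⁻¹)
    rw [mul_mul_mul_comm, e1, e2, mul_one]
  have hX : ρ X = -PowerSeries.C (n + 1 : ℝ) * X := by rw [hρ, rescale_X, map_neg]
  have hC (c : ℝ) : ρ (PowerSeries.C c) = PowerSeries.C c := rescale_C _ c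
  have hl (c : ℝ) : ρ (lin c) = lin (-(n + 1 : ℝ) * c) := rescale_lin _ c
  have hpole : ρ (pole n) = -(PowerSeries.C (n + 1 : ℝ) ^ 2 * (1 - X)) := by
    rw [pole_eq, map_neg, map_add, map_pow, map_mul, hX, hC]
    ring
  have hA1 : ρ (pole n - X ^ 2) = PowerSeries.C (-(n + 1 : ℝ) ^ 2) * (1 - (X - X ^ 2)) := by
    rw [map_sub, hpole, map_pow, hX, map_neg, map_pow]
    ring
  have hA2 : ρ (pole n + 2 * X ^ 2) = PowerSeries.C (-(n + 1 : ℝ) ^ 2) * (lin 1 * (1 - 2 * X)) := by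
    rw [map_add, hpole, map_mul, map_pow, hX, map_neg, map_pow, map_ofNat, lin, map_one]
    ring
  have hJ : ρ (poleInv n) = PowerSeries.C (-((n + 1 : ℝ) ^ 2)⁻¹) * (lin (-1))⁻¹ := by
    rw [poleInv, map_mul, hC]
    congr 1
    have h := congrArg ρ (lin_mul_inv (n + 1 : ℝ)⁻¹)
    rw [map_mul, hl, map_one, neg_mul, mul_inv_cancel₀ hν] at h
    have h' := lin_mul_inv (-1)
    linear_combination (lin (-1))⁻¹ * h - ρ ((lin (n + 1 : ℝ)⁻¹)⁻¹) * h'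
  have hK : ρ (∏ m ∈ range n, lin (m + 1 : ℝ)⁻¹) ^ 2 =
      ∏ m ∈ range n, (1 - PowerSeries.C ((n + 1 : ℝ) / (m + 1)) * X) ^ 2 := by
    rw [map_prod, ← prod_pow]
    refine prod_congr rfl fun m _ => ?_
    rw [hl, lin, div_eq_mul_inv, neg_mul, map_neg]
    ring
  have h2 : -(n + 1 : ℝ) * (n + n + 2 : ℝ)⁻¹ = -(1 / 2) := by
    have : (n + n + 2 : ℝ) = 2 * (n + 1) := by ring
    rw [this]
    field_simp
  simp only [map_mul, map_pow ρ, hl, hX, hC, hK, h2, neg_mul (n + 1 : ℝ) (n + 1 : ℝ)⁻¹,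
    mul_inv_cancel₀ hν] at h1 hcorr
  rw [heval]
  simp only [map_mul, map_pow ρ, hA1, hA2, hJ]
  rw [termSeries, invOneSubPow_val_eq_pow, two_add_X_sub_sq]
  have h3 := lin_mul_inv (-1)
  simp only [map_pow, map_neg, map_ofNat] at h1 ⊢
  generalize ρ P₀ = P at *
  generalize ρ (poleWeight (n + 1 + l) n) = W at *
  generalize ρ (∏ j ∈ range (n + 1), lin (((n + 1 + l : ℕ) + j + 1 : ℝ)⁻¹)) = D₁ at *
  generalize ρ (∏ j ∈ range (n + 1), lin (-(l + j + 1 : ℝ)⁻¹)) = D₂ at *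
  generalize corrSeries n l = c at *
  generalize ∏ m ∈ range n, (1 - PowerSeries.C ((n + 1 : ℝ) / (m + 1)) * X) ^ 2 = K at *
  generalize (lin (-1))⁻¹ = J at *
  generalize lin (-1) = J' at *
  generalize PowerSeries.C (n + 1 : ℝ) = ν at *
  generalize PowerSeries.C (((n + 1 : ℝ) ^ 2)⁻¹) = μ at *
  have h4 : P * W = 2 * ν ^ 2 * X * lin (-(1 / 2)) * J' * K * c := by
    linear_combination c * h1 - P * W * hcorr
  -- One of the q + 2 factors 1/(1 - X) is cancelled by the rescaled 1 + t/(n + 1) from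
  -- `prod_residue`.
  have h5 : (J' * J) * J ^ (q + 1) = J ^ (q + 1) := by rw [h3, one_mul]
  rw [mul_pow (-μ)]
  calc _ = (P * W) * ((-ν ^ 2 * (1 - (X - X ^ 2))) ^ α * (-ν ^ 2 * (lin 1 * (1 - 2 * X)))) *
        ((-μ) ^ (q + 1 + 1) * J ^ (q + 1 + 1)) := by ring
    _ = 2 * ν ^ 2 * X * lin (-(1 / 2)) * K * c *
        ((-ν ^ 2 * (1 - (X - X ^ 2))) ^ α * (-ν ^ 2 * (lin 1 * (1 - 2 * X)))) *
        ((-μ) ^ (q + 1 + 1) * ((J' * J) * J ^ (q + 1))) := by rw [h4]; ring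
    _ = _ := by rw [h5, mul_pow]; ring

theorem coeff_residue (α d n l : ℕ) :
    coeff (α + d + 2) ((numPoly α (n + 1 + l)).eval (pole n) * poleWeight (n + 1 + l) n *
      poleInv n ^ (α + d + 2 + 1)) =
    (-1) ^ α * ((((n + 1 : ℕ) : ℝ) ^ (α + 3 * d + 4))⁻¹ *
      coeff (α + d + 1) (termSeries α (α + d + 1) n * corrSeries n l)) := by
  have h := congrArg (coeff (α + d + 1 + 1)) (rescale_residue α (α + d + 1) n l)
  rw [coeff_rescale, coeff_C_mul, coeff_succ_X_mul] at h
  have hν : (n + 1 : ℝ) ≠ 0 := by positivity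
  have hq : (-(n + 1 : ℝ)) ^ (α + d + 1 + 1) ≠ 0 := pow_ne_zero _ (neg_ne_zero.2 hν)
  refine mul_left_cancel₀ hq (h.trans ?_)
  rw [← mul_assoc, ← mul_assoc]
  congr 1
  rw [neg_pow (n + 1 : ℝ), neg_pow ((n + 1 : ℝ) ^ 2), neg_pow ((n + 1 : ℝ) ^ 2)⁻¹]
  push_cast
  generalize (n + 1 : ℝ) = ν at hν
  rw [inv_pow, ← pow_mul, ← pow_mul]
  field_simp
  ring

theorem sum_coeff_termSeries_mul_corrSeries (α d N : ℕ) :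
    ∑ n ∈ range N, (((n + 1 : ℕ) : ℝ) ^ (α + 3 * d + 4))⁻¹ *
      coeff (α + d + 1) (termSeries α (α + d + 1) n * corrSeries n (N - (n + 1))) = 0 := by
  have h := coeff_sum_residues α N (α + d + 2) (by omega)
  rw [map_sum] at h
  have h2 : (-1 : ℝ) ^ α * ∑ n ∈ range N, (((n + 1 : ℕ) : ℝ) ^ (α + 3 * d + 4))⁻¹ *
      coeff (α + d + 1) (termSeries α (α + d + 1) n * corrSeries n (N - (n + 1))) = 0 := by
    rw [mul_sum, ← h]
    refine sum_congr rfl fun n hn => ?_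
    have hn' := mem_range.1 hn
    have h3 := coeff_residue α d n (N - (n + 1))
    rw [show n + 1 + (N - (n + 1)) = N by omega] at h3
    rw [h3]
  exact (mul_eq_zero.1 h2).resolve_left (pow_ne_zero _ (by norm_num))

/-! ### Geometric coefficient bounds and dominated convergence. -/

/-- The coefficient of `u ^ k` in `F` is bounded by `c ^ k`. -/
def GeomBounded (c : ℝ) (F : ℝ⟦X⟧) : Prop := 0 ≤ c ∧ ∀ k, |coeff k F| ≤ c ^ k

namespace GeomBounded

theorem one : GeomBounded 0 1 := ⟨le_rfl, fun k => by
  rw [coeff_one]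
  split_ifs with h <;> simp [h]⟩

/-- The Cauchy product is bounded by the sum of c^i d^(k-i), hence by (c + d)^k because binomial
coefficients are at least 1. Thus the bounds add under products. -/
theorem mul {c d : ℝ} {F G : ℝ⟦X⟧} (hF : GeomBounded c F) (hG : GeomBounded d G) :
    GeomBounded (c + d) (F * G) := by
  refine ⟨add_nonneg hF.1 hG.1, fun k => ?_⟩
  have hc := hF.1
  have hd := hG.1
  rw [coeff_mul, (Commute.all c d).add_pow']
  refine (abs_sum_le_sum_abs _ _).trans (sum_le_sum fun p hp => ?_)
  rw [abs_mul]
  have h1 : |coeff p.1 F| * |coeff p.2 G| ≤ c ^ p.1 * d ^ p.2 :=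
    mul_le_mul (hF.2 _) (hG.2 _) (abs_nonneg _) (by positivity)
  refine h1.trans ?_
  rw [nsmul_eq_mul]
  refine le_mul_of_one_le_left (by positivity) ?_
  have := Nat.choose_pos (show p.1 ≤ k by have := mem_antidiagonal.1 hp; omega)
  exact_mod_cast this

theorem mono {c d : ℝ} {F : ℝ⟦X⟧} (hF : GeomBounded c F) (h : c ≤ d) : GeomBounded d F :=
  ⟨hF.1.trans h, fun k => (hF.2 k).trans (pow_le_pow_left₀ hF.1 h k)⟩

theorem pow {c : ℝ} {F : ℝ⟦X⟧} (hF : GeomBounded c F) (n : ℕ) : GeomBounded (n * c) (F ^ n) := by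
  induction n with
  | zero => simpa using one
  | succ n ih =>
    rw [pow_succ]
    refine (ih.mul hF).mono ?_
    push_cast
    linarith

theorem prod {ι : Type*} (s : Finset ι) {c : ι → ℝ} {F : ι → ℝ⟦X⟧}
    (h : ∀ i ∈ s, GeomBounded (c i) (F i)) : GeomBounded (∑ i ∈ s, c i) (∏ i ∈ s, F i) := by
  classical
  induction s using Finset.induction_on with
  | empty => simpa using one
  | insert a s ha ih =>
    rw [sum_insert ha, prod_insert ha]
    exact (h a (mem_insert_self a s)).mul (ih fun i hi => h i (mem_insert_of_mem hi))

theorem lin (c : ℝ) : GeomBounded |c| (lin c) := by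
  refine ⟨abs_nonneg c, fun k => ?_⟩
  rw [Virasoro.lin, map_add, coeff_C_mul, coeff_one, coeff_X]
  rcases k with _ | _ | k
  · simp
  · simp
  · simp

theorem lin_inv (c : ℝ) : GeomBounded |c| (Virasoro.lin c)⁻¹ := by
  refine ⟨abs_nonneg c, fun k => ?_⟩
  have h := lin_mul_inv c
  rw [Virasoro.lin, add_mul, one_mul, mul_assoc, ← Virasoro.lin] at h
  have hk : coeff k (Virasoro.lin c)⁻¹ = (-c) ^ k := by
    induction k with
    | zero =>
      have h0 := congrArg (coeff 0) h
      rw [map_add, coeff_C_mul, coeff_zero_X_mul] at h0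
      simpa using h0
    | succ k ih =>
      have h0 := congrArg (coeff (k + 1)) h
      rw [map_add, coeff_C_mul, coeff_succ_X_mul, ih, coeff_one, if_neg (by omega)] at h0
      rw [pow_succ]
      linarith
  rw [hk, abs_pow, abs_neg]

theorem one_sub_X_sub_sq : GeomBounded 1 (1 - (X - X ^ 2)) := by
  refine ⟨zero_le_one, fun k => ?_⟩
  rw [one_pow, map_sub, map_sub, coeff_one, coeff_X, coeff_X_pow]
  rcases k with _ | _ | _ | k <;> simp

end GeomBounded

theorem geomBounded_corrSeries (n l : ℕ) :
    GeomBounded (∑ j ∈ range (n + 1), ((n + 1 : ℝ) / ((n + 1 + l : ℕ) + j + 1) +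
      (n + 1 : ℝ) / (l + j + 1))) (corrSeries n l) := by
  refine GeomBounded.prod _ fun j _ => ?_
  convert (GeomBounded.lin_inv _).mul (GeomBounded.lin_inv _) using 2
  · rw [abs_mul, abs_neg, abs_of_nonneg (by positivity), abs_of_nonneg (by positivity),
      div_eq_mul_inv]
  · rw [abs_mul, abs_neg, abs_neg, abs_of_nonneg (by positivity), abs_of_nonneg (by positivity),
      div_eq_mul_inv]

theorem coeff_zero_corrSeries (n l : ℕ) : coeff 0 (corrSeries n l) = 1 := by
  rw [coeff_zero_eq_constantCoeff_apply, corrSeries, map_prod]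
  refine prod_eq_one fun j _ => ?_
  rw [map_mul, constantCoeff_inv, constantCoeff_inv, constantCoeff_lin, constantCoeff_lin]
  norm_num

/-- For fixed n the geometric bound of the correction is a sum of n + 1 terms tending to 0, while
its constant coefficient is 1. -/
theorem tendsto_coeff_corrSeries (n k : ℕ) :
    Tendsto (fun l => coeff k (corrSeries n l)) atTop (𝓝 (coeff k 1)) := by
  rcases k with _ | k
  · simp only [coeff_zero_corrSeries, coeff_zero_one]
    exact tendsto_const_nhds
  · rw [coeff_one, if_neg (by omega)]
    refine squeeze_zero_norm (fun l => (geomBounded_corrSeries n l).2 (k + 1)) ?_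
    have h : Tendsto (fun l : ℕ => ∑ j ∈ range (n + 1), ((n + 1 : ℝ) / ((n + 1 + l : ℕ) + j + 1) +
        (n + 1 : ℝ) / (l + j + 1))) atTop (𝓝 (∑ j ∈ range (n + 1), (0 + 0))) := by
      have hl : Tendsto (fun l : ℕ => (l : ℝ)) atTop atTop := tendsto_natCast_atTop_atTop
      refine tendsto_finsetSum _ fun j _ => Tendsto.add ?_ ?_
      · refine Tendsto.const_div_atTop ?_ _
        refine tendsto_atTop_mono (fun l => ?_) hl
        push_cast
        linarith [(Nat.cast_nonneg n : (0 : ℝ) ≤ n), (Nat.cast_nonneg j : (0 : ℝ) ≤ j)]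
      · refine Tendsto.const_div_atTop ?_ _
        refine tendsto_atTop_mono (fun l => ?_) hl
        linarith [(Nat.cast_nonneg j : (0 : ℝ) ≤ j)]
    simpa using h.pow (k + 1)

theorem tendsto_coeff_mul_corrSeries (F : ℝ⟦X⟧) (n k : ℕ) :
    Tendsto (fun l => coeff k (F * corrSeries n l)) atTop (𝓝 (coeff k F)) := by
  have h : coeff k F = coeff k (F * 1) := by rw [mul_one]
  rw [h]
  simp only [coeff_mul]
  exact tendsto_finsetSum _ fun p _ => (tendsto_coeff_corrSeries n p.2).const_mul _

/-- The harmonic number `∑_{0 < j ≤ n + 1} 1 / j`. -/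
noncomputable def harm (n : ℕ) : ℝ := ∑ j ∈ range (n + 1), (j + 1 : ℝ)⁻¹

theorem one_le_harm (n : ℕ) : 1 ≤ harm n := by
  rw [harm, sum_range_succ']
  have : 0 ≤ ∑ j ∈ range n, (((j + 1 : ℕ) : ℝ) + 1)⁻¹ := sum_nonneg fun j _ => by positivity
  simpa using this

/-- This is x^Q / Q! ≤ exp x at x = 1 + log(n + 1). -/
theorem harm_pow_le (n Q : ℕ) : harm n ^ Q ≤ Q.factorial * Real.exp 1 * (n + 1 : ℝ) := by
  have h1 : harm n ≤ 1 + Real.log (n + 1 : ℝ) := by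
    have := harmonic_le_one_add_log (n + 1)
    rw [harmonic] at this
    push_cast at this
    exact this
  have h0 : 0 ≤ harm n := zero_le_one.trans (one_le_harm n)
  have h2 := Real.pow_div_factorial_le_exp (1 + Real.log (n + 1 : ℝ)) (h0.trans h1) Q
  rw [Real.exp_add, Real.exp_log (by positivity), div_le_iff₀ (by positivity)] at h2
  calc harm n ^ Q ≤ (1 + Real.log (n + 1 : ℝ)) ^ Q := pow_le_pow_left₀ h0 h1 Q
    _ ≤ _ := h2
    _ = _ := by ring

/-- The bound is uniform in l, as domination requires. The fixed factors contribute Q + α + 9/2,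
rounded up to Q + α + 5. The squared product and the correction contribute at most 2(n + 1) times
the harmonic number each. -/
theorem abs_coeff_termSeries_mul_corrSeries_le (α Q n l : ℕ) :
    |coeff Q (termSeries α Q n * corrSeries n l)| ≤
      2 * ((Q + α + 9) * ((n + 1) * harm n)) ^ Q := by
  have hν : (0 : ℝ) < n + 1 := by positivity
  have h1 : termSeries α Q n * corrSeries n l = PowerSeries.C 2 *
      (lin (-2) * ((lin (-1))⁻¹) ^ (Q + 1) * ((lin (-(1 / 2)) * lin 1) * (1 - (X - X ^ 2)) ^ α *
        ∏ m ∈ range n, lin (-((n + 1 : ℝ) / (m + 1))) ^ 2) * corrSeries n l) := by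
    have h2 : lin (-2) = 1 - 2 * X := by
      rw [lin, map_neg, map_ofNat]
      ring
    have h3 : ∏ m ∈ range n, lin (-((n + 1 : ℝ) / (m + 1))) ^ 2 =
        ∏ m ∈ range n, (1 - PowerSeries.C ((n + 1 : ℝ) / (m + 1)) * X) ^ 2 := by
      refine prod_congr rfl fun m _ => ?_
      rw [lin, map_neg]
      ring
    rw [h2, h3, termSeries, two_add_X_sub_sq, invOneSubPow_val_eq_pow]
    ring
  have hb := (((GeomBounded.lin (-2)).mul ((GeomBounded.lin_inv (-1)).pow (Q + 1))).mul
    ((((GeomBounded.lin (-(1 / 2))).mul (GeomBounded.lin 1)).mul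
      (GeomBounded.one_sub_X_sub_sq.pow α)).mul (GeomBounded.prod (range n) fun m _ =>
        (GeomBounded.lin (-((n + 1 : ℝ) / (m + 1)))).pow 2))).mul (geomBounded_corrSeries n l)
  have hb2 := hb.mono (d := (Q + α + 9) * ((n + 1) * harm n)) ?_
  · rw [h1, coeff_C_mul, abs_mul, abs_of_nonneg (by norm_num : (0 : ℝ) ≤ 2)]
    exact mul_le_mul_of_nonneg_left (hb2.2 Q) (by norm_num)
  · have e1 : ∑ m ∈ range n, (((2 : ℕ) : ℝ) * |-((n + 1 : ℝ) / (m + 1))|) ≤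
        2 * ((n + 1) * harm n) := by
      rw [harm, mul_sum, mul_sum]
      refine (sum_le_sum_of_subset_of_nonneg (range_subset_range.2 (Nat.le_succ n))
        fun _ _ _ => by positivity).trans (sum_le_sum fun m _ => ?_)
      rw [abs_neg, abs_of_nonneg (by positivity), div_eq_mul_inv]
      norm_num
    have e2 : ∑ j ∈ range (n + 1), ((n + 1 : ℝ) / ((n + 1 + l : ℕ) + j + 1) +
        (n + 1 : ℝ) / (l + j + 1)) ≤ 2 * ((n + 1) * harm n) := by
      rw [harm, mul_sum, mul_sum]
      refine sum_le_sum fun j _ => ?_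
      have a1 : (n + 1 : ℝ) / ((n + 1 + l : ℕ) + j + 1) ≤ (n + 1) * (j + 1 : ℝ)⁻¹ := by
        rw [← div_eq_mul_inv]
        gcongr
        exact le_add_of_nonneg_left (Nat.cast_nonneg _)
      have a2 : (n + 1 : ℝ) / (l + j + 1) ≤ (n + 1) * (j + 1 : ℝ)⁻¹ := by
        rw [← div_eq_mul_inv]
        gcongr
        exact le_add_of_nonneg_left (Nat.cast_nonneg _)
      linarith
    have e3 : 1 ≤ (n + 1) * harm n := by
      have := one_le_harm n
      have hn : (0 : ℝ) ≤ n := Nat.cast_nonneg n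
      nlinarith
    have e4 : (Q + α + 5 : ℝ) ≤ (Q + α + 5) * ((n + 1) * harm n) :=
      le_mul_of_one_le_right (by positivity) e3
    have e5 : |(-2 : ℝ)| = 2 := by norm_num
    have e6 : |(-(1 / 2) : ℝ)| = 1 / 2 := by norm_num
    rw [e5, e6, abs_neg, abs_one]
    push_cast at e1 e2 ⊢
    linarith

theorem e_eq_zero (α d : ℕ) : e (-(α + 1 : ℤ)) (α + d + 1 + 1) = 0 := by
  let K : ℕ := α + 3 * d + 4
  let Q : ℕ := α + d + 1
  -- The N-th finite residue sum is extended by zero to all n.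
  let f : ℕ → ℕ → ℝ := fun N n => if n < N then (((n + 1 : ℕ) : ℝ) ^ K)⁻¹ *
    coeff Q (termSeries α Q n * corrSeries n (N - (n + 1))) else 0
  let M : ℝ := 2 * (Q + α + 9) ^ Q * (Q.factorial * Real.exp 1)
  have hM : 0 ≤ M := by positivity
  have hsum : Summable fun n : ℕ => M * (((n + 1 : ℕ) : ℝ) ^ 2)⁻¹ :=
    (((summable_nat_add_iff 1).2 (Real.summable_nat_pow_inv.2 one_lt_two))).mul_left M
  have hbound (N n : ℕ) : ‖f N n‖ ≤ M * (((n + 1 : ℕ) : ℝ) ^ 2)⁻¹ := by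
    simp only [f]
    split_ifs with h
    · have hν : (1 : ℝ) ≤ ((n + 1 : ℕ) : ℝ) := by exact_mod_cast Nat.succ_pos n
      have hν0 : (0 : ℝ) < ((n + 1 : ℕ) : ℝ) := by positivity
      have h1 := abs_coeff_termSeries_mul_corrSeries_le α Q n (N - (n + 1))
      have h2 := harm_pow_le n Q
      rw [Real.norm_eq_abs, abs_mul, abs_of_nonneg (by positivity)]
      rw [mul_pow, mul_pow] at h1
      calc (((n + 1 : ℕ) : ℝ) ^ K)⁻¹ * |coeff Q (termSeries α Q n * corrSeries n (N - (n + 1)))|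
          ≤ (((n + 1 : ℕ) : ℝ) ^ K)⁻¹ * (2 * ((Q + α + 9) ^ Q * ((n + 1) ^ Q *
            (Q.factorial * Real.exp 1 * (n + 1 : ℝ))))) := by
            refine mul_le_mul_of_nonneg_left (h1.trans ?_) (by positivity)
            gcongr
        _ = M * ((((n + 1 : ℕ) : ℝ) ^ K)⁻¹ * ((n + 1 : ℕ) : ℝ) ^ (Q + 1)) := by
            simp only [M]
            push_cast
            ring
        _ ≤ M * (((n + 1 : ℕ) : ℝ) ^ 2)⁻¹ := by
            refine mul_le_mul_of_nonneg_left ?_ hM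
            rw [inv_mul_le_iff₀ (by positivity), ← div_eq_mul_inv, le_div_iff₀ (by positivity),
              ← pow_add]
            -- Here K - (Q + 1) = 2d + 2 ≥ 2, so the terms are dominated by a multiple of (n +
            -- 1)^(-2).
            exact pow_le_pow_right₀ hν (by simp only [K, Q]; omega)
    · rw [norm_zero]
      positivity
  have hlim (n : ℕ) : Tendsto (fun N => f N n) atTop
      (𝓝 ((((n + 1 : ℕ) : ℝ) ^ K)⁻¹ * coeff Q (termSeries α Q n))) := by
    have h1 := ((tendsto_coeff_mul_corrSeries (termSeries α Q n) n Q).comp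
      (tendsto_sub_atTop_nat (n + 1))).const_mul (((n + 1 : ℕ) : ℝ) ^ K)⁻¹
    refine h1.congr' ?_
    filter_upwards [eventually_gt_atTop n] with N hN
    simp only [f, if_pos hN, Function.comp_apply]
  have h := tendsto_tsum_of_dominated_convergence hsum hlim (Eventually.of_forall hbound)
  have hzero (N : ℕ) : ∑' n, f N n = 0 := by
    rw [tsum_eq_sum (s := range N) fun n hn => if_neg fun h => hn (mem_range.2 h)]
    rw [← sum_coeff_termSeries_mul_corrSeries α d N]
    exact sum_congr rfl fun n hn => if_pos (mem_range.1 hn)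
  simp only [hzero] at h
  rw [← (hasSum_e α d).tsum_eq]
  exact tendsto_nhds_unique h tendsto_const_nhds

end Virasoro

theorem theorem3 (p : ℤ) (q : ℕ) (hqp : -(q : ℤ) < p) (hp : p < 0) :
    Virasoro.e p q = 0 := by
  -- The hypothesis p < 0 makes (1 - y)^(-(p+1)) the polynomial (1 - y)^α, and -q < p gives q ≥ α +
  -- 2.
  obtain ⟨α, hα⟩ : ∃ α : ℕ, p = -(α + 1 : ℤ) := ⟨(-p - 1).toNat, by omega⟩
  obtain ⟨d, hd⟩ : ∃ d : ℕ, q = α + d + 1 + 1 := ⟨q - (α + 2), by omega⟩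
  rw [hα, hd]
  exact Virasoro.e_eq_zero α d
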